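/- Let $\mathcal{A}$ be a nonempty finite set, let $F$ be a set of maps $\mathcal{A}\to\mathcal{A}$, and let $\mathcal{F}\subseteq F^{\mathbb{Z}}$ be a functional shift, i.e. a shift space over the alphabet $F$. (For a set $\mathtt{B}$ of finite blocks over an alphabet, $X_{\mathtt{B}}$ denotes the set of bi-infinite sequences over that alphabet in which no block of $\mathtt{B}$ occurs; a shift space is a set of the form $X_{\mathtt{B}}$.) Let $\mathcal{B}_n(\mathcal{F})$ be the set of blocks of length $n$ occurring in points of $\mathcal{F}$, let $\mathcal{B}(\mathcal{F})=\bigcup_{n\ge 0}\mathcal{B}_n(\mathcal{F})$ be the language of $\mathcal{F}$, and let $$X_{\mathcal{F}}=\{x\in\mathcal{A}^{\mathbb{Z}} : \exists f\in\mathcal{F}\ \forall i\in\mathbb{Z}\ \ x_{i+1}=f_i(x_i)\}$$ be the shift generated by $\mathcal{F}$. For $n\in\mathbb{N}$ and a block $x\in\mathcal{A}^*$ put $$\mathcal{D}_{\mathcal{F}}(n,x)=\{y=ax : a\in\mathcal{A}^n,\ \exists f\in\mathcal{B}_{|y|-1}(\mathcal{F})\ \forall i\ \ y_{i+1}=f_i(y_i)\},$$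 where $|y|-1$ is read as $0$ if $y$ is the empty block. A language $L$ is called context sensitive if its set of nonempty words is generated by a grammar with finitely many nonterminals and finitely many productions, all of the form $\alpha\to\beta$ with $1\le|\alpha|\le|\beta|$. Theorem. If $\mathcal{B}(\mathcal{F})$ is context sensitive, then the set of forbidden blocks $$\mathtt{F}=\{x\in\mathcal{A}^* : \mathcal{D}_{\mathcal{F}}(0,x)=\emptyset\}$$ is a context sensitive language and $X_{\mathtt{F}}=X_{\mathcal{F}}$. In particular, $X_{\mathcal{F}}$ is described by a context sensitive language of forbidden blocks. -/

import Mathlib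

universe u

namespace FunctionalShift

/-! ### Grammars -/

/-- A context sensitive (type-1, length-nondecreasing) grammar with terminal alphabet `T`:
finitely many nonterminals, a start symbol, and finitely many productions `α → β` over the
disjoint union of terminals and nonterminals, with `α` nonempty and `|α| ≤ |β|`. -/
structure ContextSensitiveGrammar (T : Type u) where
  /-- The nonterminal symbols. -/
  NT : Type u
  finite_NT : Finite NT
  /-- The start symbol. -/
  start : NT
  /-- The productions, as pairs `(α, β)`. -/
  rules : Set (List (Symbol T NT) × List (Symbol T NT))
  finite_rules : rules.Finite
  lhs_ne_nil : ∀ r ∈ rules, r.1 ≠ []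
  length_le : ∀ r ∈ rules, r.1.length ≤ r.2.length

/-- One derivation step: `γ α δ ⟹ γ β δ` for a production `α → β`. -/
def ContextSensitiveGrammar.Produces {T : Type u} (g : ContextSensitiveGrammar T)
    (u v : List (Symbol T g.NT)) : Prop :=
  ∃ r ∈ g.rules, ∃ γ δ : List (Symbol T g.NT), u = γ ++ r.1 ++ δ ∧ v = γ ++ r.2 ++ δ

/-- The language generated by a grammar: the words over the terminals that are derivable
from the start symbol. -/
def ContextSensitiveGrammar.language {T : Type u} (g : ContextSensitiveGrammar T) : Language T :=
  {w | Relation.ReflTransGen g.Produces [Symbol.nonterminal g.start] (w.map Symbol.terminal)}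

/-- A language is context sensitive if its nonempty words are exactly the words generated by some
context sensitive grammar. Such a grammar never generates the empty word, so, as usual, membership
of the empty word is disregarded. -/
def IsContextSensitive {T : Type u} (L : Language T) : Prop :=
  ∃ g : ContextSensitiveGrammar T, ∀ w : List T, w ∈ g.language ↔ w ∈ L ∧ w ≠ []

/-! ### Shift spaces -/

/-- The block `w` occurs in the bi-infinite sequence `x`. -/
def Occurs {T : Type u} (w : List T) (x : ℤ → T) : Prop :=
  ∃ k : ℤ, ∀ (i : ℕ) (hi : i < w.length), x (k + i) = w[i]

/-- The set of bi-infinite sequences in which no forbidden block occurs. -/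
def shiftOfForbidden {T : Type u} (B : Set (List T)) : Set (ℤ → T) :=
  {x | ∀ w ∈ B, ¬ Occurs w x}

/-- A shift space is a set of sequences described by some collection of forbidden blocks. -/
def IsShiftSpace {T : Type u} (X : Set (ℤ → T)) : Prop :=
  ∃ B : Set (List T), X = shiftOfForbidden B

/-- The `n`-blocks that occur in points of `X`. -/
def blocks {T : Type u} (n : ℕ) (X : Set (ℤ → T)) : Set (List T) :=
  {w | w.length = n ∧ ∃ x ∈ X, Occurs w x}

/-- The language of `X`: all blocks that occur in points of `X`. -/
def shiftLanguage {T : Type u} (X : Set (ℤ → T)) : Language T :=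
  ⋃ n : ℕ, blocks n X

/-! ### Generated shifts -/

/-- The generated shift: the sequences `x` over `A` that are driven by some sequence of maps
belonging to `S`. -/
def generatedShift {A : Type u} {F : Set (A → A)} (S : Set (ℤ → F)) : Set (ℤ → A) :=
  {x | ∃ f ∈ S, ∀ i : ℤ, x (i + 1) = (f i : A → A) (x i)}

/-- `predecessors S n x` is the set of blocks `y = a x` with `|a| = n` for which there is a block
`f` of length `|y| - 1` in the language of `S` with `y_{i+1} = f_i (y_i)` for all `i`. For the empty
block `y` the length `|y| - 1` is read as `0`. -/
def predecessors {A : Type u} {F : Set (A → A)} (S : Set (ℤ → F)) (n : ℕ) (x : List A) :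
    Set (List A) :=
  {y | ∃ a : List A, a.length = n ∧ y = a ++ x ∧
    ∃ f ∈ blocks (y.length - 1) S, ∀ (i : ℕ) (hy : i + 1 < y.length) (hf : i < f.length),
      y[i + 1] = (f[i] : A → A) y[i]}

/-- The collection of forbidden blocks `{x | predecessors S 0 x = ∅}`. -/
def forbiddenBlocks {A : Type u} {F : Set (A → A)} (S : Set (ℤ → F)) : Language A :=
  {x | predecessors S 0 x = ∅}

end FunctionalShift

/-!
The set of forbidden blocks is the complement of the set of blocks that are driven by a block of the
language of `S`. Appending one irrelevant map makes the driving block as long as the driven one, so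
that the driven blocks arise from a context sensitive language by a local (hence regular) condition
and a projection. The heart of the matter is therefore that context sensitive languages are closed
under complements, the theorem of Immerman and Szelepcsényi.

Context sensitive languages are handled through the class `NLin`: a property of words is in `NLin`
if it is decided by reachability in a graph whose vertices are words of the same length over a
finite alphabet and whose edges, initial vertices and final vertices are recognised by finite
automata.
Words of length `n + 1` are functions on `Fin (n + 1)`, so tuples of words of equal length are words
over a product alphabet. The class contains all regular properties and is closed under conjunction,
disjunction, quantification over words of the same length, and reflexive transitive closure
(`NLin.and`, `NLin.or`, `NLin.exists`, `NLin.forall`, `NLin.reflTransGen`). Inductive counting can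
then be written down as a formula: words are numbered in base `b`, a walk through all words with a
second word as a counter determines the size of a set of words (`IsNumbering.count_iff`), the size
of the set of vertices reached in at most `k` steps certifies that a vertex is not among them
(`IsNumbering.notInLayer_iff`), and from this the size of the next such set is computed. The outcome
is `IsNumbering.not_reachable_iff`, hence `NLin.not`.

A context sensitive grammar is simulated by a graph on words padded with blanks
(`ContextSensitiveGrammar.nlin_language`). Conversely, a graph given by automata is simulated by a
grammar whose sentential forms are tapes with a single head that sweeps back and forth and executes
the automata (`NLin.exists_grammar`).

The equality of the two shifts is a compactness argument: if no block of `x` is forbidden, then the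
points of `S` that drive `x` on a window form a decreasing sequence of nonempty closed subsets of a
compact space (`shiftOfForbidden_forbiddenBlocks`).
-/

namespace FunctionalShift

open Relation

/-! ### Regular predicates on words -/

/-- Regular languages are closed under concatenation. -/
theorem isRegular_mul {α : Type*} {K L : Language α} (hK : K.IsRegular) (hL : L.IsRegular) :
    (K * L).IsRegular := by
  classical
  obtain ⟨σ, _, M, rfl⟩ := hK
  obtain ⟨τ, _, N, rfl⟩ := hL
  -- The second component collects the states of all copies of `N` started after a prefix in `K`.
  let D : DFA α (σ × Set τ) :=
    { step := fun p a => (M.step p.1 a, {t | (∃ s ∈ p.2, t = N.step s a) ∨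
        (M.step p.1 a ∈ M.accept ∧ t = N.start)})
      start := (M.start, {t | M.start ∈ M.accept ∧ t = N.start})
      accept := {p | ∃ t ∈ p.2, t ∈ N.accept} }
  have key : ∀ x : List α, (D.eval x).1 = M.eval x ∧
      ∀ t, t ∈ (D.eval x).2 ↔ ∃ y z, x = y ++ z ∧ y ∈ M.accepts ∧ t = N.eval z := by
    intro x
    induction x using List.reverseRecOn with
    | nil =>
      refine ⟨rfl, fun t => ?_⟩
      simp [D, DFA.eval_nil, DFA.mem_accepts]
    | append_singleton x a ih =>
      obtain ⟨ih1, ih2⟩ := ih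
      have e1 : (D.eval (x ++ [a])).1 = M.eval (x ++ [a]) := by
        simp only [DFA.eval_append_singleton]
        simp [D, ← ih1]
      refine ⟨e1, fun t => ?_⟩
      have e2 : t ∈ (D.eval (x ++ [a])).2 ↔ (∃ s ∈ (D.eval x).2, t = N.step s a) ∨
          (M.step (D.eval x).1 a ∈ M.accept ∧ t = N.start) := by
        simp only [DFA.eval_append_singleton]
        simp [D]
      rw [e2, ih1, ← DFA.eval_append_singleton]
      constructor
      · rintro (⟨s, hs, rfl⟩ | ⟨h, rfl⟩)
        · obtain ⟨y, z, rfl, hy, rfl⟩ := (ih2 s).1 hs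
          exact ⟨y, z ++ [a], by simp, hy, by simp⟩
        · exact ⟨x ++ [a], [], by simp, h, by simp⟩
      · rintro ⟨y, z, hx, hy, rfl⟩
        rcases List.eq_nil_or_concat z with rfl | ⟨z, b, rfl⟩
        · rw [List.append_nil] at hx
          subst hx
          exact Or.inr ⟨hy, rfl⟩
        · rw [List.concat_eq_append, ← List.append_assoc] at hx
          obtain ⟨rfl, hab⟩ := List.append_inj' hx rfl
          cases hab
          exact Or.inl ⟨_, (ih2 _).2 ⟨y, z, rfl, hy, rfl⟩, by simp⟩
  refine Language.isRegular_iff.2 ⟨σ × Set τ, inferInstance, D, ?_⟩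
  ext x
  rw [Language.mem_mul]
  constructor
  · rintro ⟨t, ht, hacc⟩
    obtain ⟨y, z, rfl, hy, rfl⟩ := ((key x).2 t).1 ht
    exact ⟨y, hy, z, hacc, rfl⟩
  · rintro ⟨y, hy, z, hz, rfl⟩
    exact ⟨_, ((key _).2 _).2 ⟨y, z, rfl, hy, rfl⟩, hz⟩

theorem isRegular_all {α : Type*} (p : α → Prop) :
    Language.IsRegular {x : List α | ∀ a ∈ x, p a} := by
  classical
  let D : DFA α Bool := { step := fun s a => s && decide (p a), start := true, accept := {true} }
  refine ⟨Bool, inferInstance, D, ?_⟩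
  ext x
  have key : D.eval x = true ↔ ∀ a ∈ x, p a := by
    induction x using List.reverseRecOn with
    | nil => simp [D, DFA.eval_nil]
    | append_singleton x a ih =>
      rw [DFA.eval_append_singleton]
      simp only [List.mem_append, List.mem_singleton, or_imp, forall_and, forall_eq]
      rw [← ih]
      simp [D]
  exact key

theorem isRegular_singleton {α : Type*} (w : List α) : ({w} : Language α).IsRegular := by
  classical
  induction w with
  | nil =>
    have h : ({[]} : Language α) = ({x | ∀ a ∈ x, False} : Set (List α)) := by
      ext x
      change x = [] ↔ ∀ a ∈ x, False
      simp [List.eq_nil_iff_forall_not_mem]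
    rw [h]
    exact isRegular_all _
  | cons a w ih =>
    have h1 : ({[a]} : Language α).IsRegular := by
      let D : DFA α (Fin 3) :=
        { step := fun s b => if s = 0 ∧ b = a then 1 else 2, start := 0, accept := {1} }
      refine ⟨Fin 3, inferInstance, D, ?_⟩
      have h2 : ∀ x, D.evalFrom 2 x = 2 := by
        intro x
        induction x with
        | nil => rfl
        | cons b x ih => rw [DFA.evalFrom_cons]; simpa [D] using ih
      ext x
      rw [DFA.mem_accepts]
      change D.evalFrom 0 x = 1 ↔ x = [a]
      match x with
      | [] => simp
      | [b] => by_cases hb : b = a <;> simp [D, hb]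
      | b :: c :: x =>
        rw [DFA.evalFrom_cons, DFA.evalFrom_cons]
        have : D.step (D.step 0 b) c = 2 := by
          by_cases hb : b = a <;> simp [D, hb]
        rw [this, h2]
        simp
    convert isRegular_mul h1 ih using 1
    ext x
    rw [Language.mem_mul]
    constructor
    · rintro rfl
      exact ⟨[a], rfl, w, rfl, rfl⟩
    · rintro ⟨y, rfl, z, rfl, rfl⟩
      rfl

/-- A property of nonempty words over `Γ` is regular if the words that have it are recognised by
a finite automaton. Nonempty words of length `n + 1` are encoded as functions on `Fin (n + 1)`, so
that a word over a product alphabet is the same as a tuple of words of equal length. -/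
def RegPred {Γ : Type*} (P : ∀ n : ℕ, (Fin (n + 1) → Γ) → Prop) : Prop :=
  ∃ L : Language Γ, L.IsRegular ∧ ∀ n u, P n u ↔ List.ofFn u ∈ L

/-- A relation between words of equal length is regular if it is recognised by a finite automaton
that reads both words synchronously. -/
def RegRel {Γ Δ : Type*} (R : ∀ n : ℕ, (Fin (n + 1) → Γ) → (Fin (n + 1) → Δ) → Prop) : Prop :=
  RegPred (Γ := Γ × Δ) fun n w => R n (fun i => (w i).1) (fun i => (w i).2)

section RegPred

variable {Γ Δ : Type*} {P Q : ∀ n : ℕ, (Fin (n + 1) → Γ) → Prop}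

theorem RegPred.not (h : RegPred P) : RegPred fun n u => ¬ P n u := by
  obtain ⟨L, hL, h⟩ := h
  exact ⟨Lᶜ, hL.compl, fun n u => not_congr (h n u)⟩

theorem RegPred.and (h : RegPred P) (h' : RegPred Q) : RegPred fun n u => P n u ∧ Q n u := by
  obtain ⟨L, hL, h⟩ := h
  obtain ⟨L', hL', h'⟩ := h'
  exact ⟨L ⊓ L', hL.inf hL', fun n u => and_congr (h n u) (h' n u)⟩

theorem RegPred.or (h : RegPred P) (h' : RegPred Q) : RegPred fun n u => P n u ∨ Q n u := by
  obtain ⟨L, hL, h⟩ := h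
  obtain ⟨L', hL', h'⟩ := h'
  exact ⟨L + L', hL.add hL', fun n u => or_congr (h n u) (h' n u)⟩

theorem RegPred.comap (f : Δ → Γ) (h : RegPred P) :
    RegPred fun n (u : Fin (n + 1) → Δ) => P n fun i => f (u i) := by
  obtain ⟨L, ⟨σ, _, M, rfl⟩, h⟩ := h
  refine ⟨_, ⟨σ, inferInstance, M.comap f, rfl⟩, fun n u => ?_⟩
  refine (h n _).trans ?_
  rw [DFA.accepts_comap]
  change _ ↔ List.map f (List.ofFn u) ∈ M.accepts
  rw [List.map_ofFn]
  rfl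

theorem RegPred.all (p : Γ → Prop) : RegPred fun n (u : Fin (n + 1) → Γ) => ∀ i, p (u i) :=
  ⟨_, isRegular_all p, fun n u => by
    change (∀ i, p (u i)) ↔ ∀ a ∈ List.ofFn u, p a
    simp only [List.mem_ofFn, forall_exists_index, forall_apply_eq_imp_iff]⟩

theorem RegPred.const (p : Prop) : RegPred fun n (_ : Fin (n + 1) → Γ) => p := by
  simpa using RegPred.all (Γ := Γ) fun _ => p

theorem RegPred.eq (f g : Γ → Δ) :
    RegPred fun n (u : Fin (n + 1) → Γ) => (fun i => f (u i)) = fun i => g (u i) := by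
  simpa only [funext_iff] using RegPred.all fun a => f a = g a

theorem RegPred.congr (h : RegPred P) (hPQ : ∀ n u, Q n u ↔ P n u) : RegPred Q := by
  obtain rfl : Q = P := by
    funext n u
    exact propext (hPQ n u)
  exact h

end RegPred

/-- The number with base `b` digits `u`, least significant digit first. -/
def wordVal {b : ℕ} (n : ℕ) (u : Fin (n + 1) → Fin b) : Fin (b ^ (n + 1)) :=
  finFunctionFinEquiv u

/-- Addition of one with carry is performed by an automaton with three states: the current carry,
and `none` for failure. -/
theorem regRel_succ (b : ℕ) : RegRel fun n (u v : Fin (n + 1) → Fin b) =>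
    (wordVal n v : ℕ) = wordVal n u + 1 := by
  classical
  let D : DFA (Fin b × Fin b) (Option (Fin 2)) :=
    { step := fun s p => s.bind fun c =>
        if (p.2 : ℕ) = p.1 + c then some 0
        else if (p.2 : ℕ) + b = p.1 + c then some 1 else none
      start := some 1
      accept := {some 0} }
  have hnone : ∀ x, D.evalFrom none x = none := by
    intro x
    induction x with
    | nil => rfl
    | cons b x ih => rw [DFA.evalFrom_cons]; simpa [D] using ih
  have key : ∀ (n : ℕ) (w : Fin n → Fin b × Fin b) (c : Fin 2),
      D.evalFrom (some c) (List.ofFn w) = some 0 ↔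
        ∑ i, ((w i).2 : ℕ) * b ^ (i : ℕ) = ∑ i, ((w i).1 : ℕ) * b ^ (i : ℕ) + c := by
    intro n
    induction n with
    | zero =>
      intro w c
      simp only [List.ofFn_zero, DFA.evalFrom_nil, Finset.univ_eq_empty, Finset.sum_empty,
        Option.some.injEq]
      omega
    | succ n ih =>
      intro w c
      have hs : ∀ f : Fin (n + 1) → Fin b, ∑ i, (f i : ℕ) * b ^ (i : ℕ) =
          f 0 + b * ∑ i : Fin n, (f i.succ : ℕ) * b ^ (i : ℕ) := by
        intro f
        rw [Fin.sum_univ_succ, Finset.mul_sum]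
        congr 1
        · simp
        · refine Finset.sum_congr rfl fun i _ => ?_
          rw [Fin.val_succ, pow_succ]
          ring
      rw [List.ofFn_succ, DFA.evalFrom_cons, hs fun i => (w i).1, hs fun i => (w i).2]
      set V := ∑ i : Fin n, ((w i.succ).2 : ℕ) * b ^ (i : ℕ) with hV
      set U := ∑ i : Fin n, ((w i.succ).1 : ℕ) * b ^ (i : ℕ) with hU
      have h1 := (w 0).1.isLt
      have h2 := (w 0).2.isLt
      have hc := c.isLt
      have hstep : D.step (some c) (w 0) = if ((w 0).2 : ℕ) = (w 0).1 + c then some 0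
        else if ((w 0).2 : ℕ) + b = (w 0).1 + c then some 1 else none := rfl
      rw [hstep]
      split_ifs with h h'
      · rw [ih fun i => w i.succ]
        simp only [← hU, ← hV, Fin.val_zero, add_zero]
        rw [h]
        constructor
        · rintro h; rw [h]; ring
        · intro h
          have : b * V = b * U := by omega
          exact Nat.eq_of_mul_eq_mul_left (by omega) this
      · rw [ih fun i => w i.succ]
        simp only [← hU, ← hV, Fin.val_one]
        constructor
        · rintro h; rw [h]; rw [mul_add]; omega
        · intro h
          have : b * V = b * (U + 1) := by rw [mul_add]; omega
          exact Nat.eq_of_mul_eq_mul_left (by omega) this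
      · rw [hnone]
        simp only [reduceCtorEq, false_iff]
        intro heq
        rcases Nat.lt_trichotomy V U with hlt | he | hgt
        · have : b * (V + 1) ≤ b * U := Nat.mul_le_mul_left _ hlt
          rw [mul_add] at this
          omega
        · rw [he] at heq
          omega
        · rcases Nat.lt_or_ge (U + 1) V with h3 | h3
          · have : b * (U + 2) ≤ b * V := Nat.mul_le_mul_left _ h3
            rw [mul_add] at this
            omega
          · have : V = U + 1 := by omega
            rw [this, mul_add] at heq
            omega
  refine ⟨D.accepts, ⟨_, inferInstance, D, rfl⟩, fun n w => ?_⟩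
  refine Iff.trans ?_ (key (n + 1) w 1).symm
  simp [wordVal]

/-! ### Predicates decided by reachability between words of the same length -/

/-- A property `P` of words over `Γ` is decided by the regular relations `I`, `E` and the regular
property `A` if `P u` means that some word related to `u` by `I` is joined to some word with
property `A` by a path with steps in `E`. -/
structure DecidedBy {Γ Δ : Type*} (P : ∀ n : ℕ, (Fin (n + 1) → Γ) → Prop)
    (I : ∀ n : ℕ, (Fin (n + 1) → Γ) → (Fin (n + 1) → Δ) → Prop)
    (E : ∀ n : ℕ, (Fin (n + 1) → Δ) → (Fin (n + 1) → Δ) → Prop)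
    (A : ∀ n : ℕ, (Fin (n + 1) → Δ) → Prop) : Prop where
  init : RegRel I
  step : RegRel E
  final : RegPred A
  iff : ∀ n u, P n u ↔ ∃ a b, I n u a ∧ ReflTransGen (E n) a b ∧ A n b

/-- A property of words is in nondeterministic linear space if it is decided by reachability in
a regular graph whose vertices are words of the same length over some finite alphabet. -/
def NLin {Γ : Type*} (P : ∀ n : ℕ, (Fin (n + 1) → Γ) → Prop) : Prop :=
  ∃ (d : ℕ) (I : ∀ n : ℕ, (Fin (n + 1) → Γ) → (Fin (n + 1) → Fin (d + 1)) → Prop)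
    (E : ∀ n : ℕ, (Fin (n + 1) → Fin (d + 1)) → (Fin (n + 1) → Fin (d + 1)) → Prop)
    (A : ∀ n : ℕ, (Fin (n + 1) → Fin (d + 1)) → Prop), DecidedBy P I E A

/-- A relation between words of equal length is in nondeterministic linear space. -/
def NLinRel {Γ Δ : Type*} (R : ∀ n : ℕ, (Fin (n + 1) → Γ) → (Fin (n + 1) → Δ) → Prop) : Prop :=
  NLin (Γ := Γ × Δ) fun n w => R n (fun i => (w i).1) (fun i => (w i).2)

/-- Recoding of the alphabet of the graph along an injection `e` with left inverse `f`. -/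
theorem DecidedBy.recode {Γ Δ Δ' : Type*} {P : ∀ n : ℕ, (Fin (n + 1) → Γ) → Prop}
    {I : ∀ n : ℕ, (Fin (n + 1) → Γ) → (Fin (n + 1) → Δ) → Prop}
    {E : ∀ n : ℕ, (Fin (n + 1) → Δ) → (Fin (n + 1) → Δ) → Prop}
    {A : ∀ n : ℕ, (Fin (n + 1) → Δ) → Prop} (h : DecidedBy P I E A)
    (e : Δ → Δ') (f : Δ' → Δ) (hfe : ∀ a, f (e a) = a) :
    DecidedBy P (fun n u a => (∀ i, e (f (a i)) = a i) ∧ I n u fun i => f (a i))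
      (fun n a b => (∀ i, e (f (b i)) = b i) ∧ E n (fun i => f (a i)) fun i => f (b i))
      (fun n b => A n fun i => f (b i)) where
  init := (RegPred.all fun p : Γ × Δ' => e (f p.2) = p.2).and
    (h.init.comap fun p : Γ × Δ' => (p.1, f p.2))
  step := (RegPred.all fun p : Δ' × Δ' => e (f p.2) = p.2).and
    (h.step.comap fun p : Δ' × Δ' => (f p.1, f p.2))
  final := h.final.comap f
  iff n u := by
    rw [h.iff]
    constructor
    · rintro ⟨a, b, ha, hab, hb⟩
      refine ⟨fun i => e (a i), fun i => e (b i), ⟨fun i => by rw [hfe], by simpa only [hfe]⟩,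
        ?_, by simpa only [hfe]⟩
      refine ReflTransGen.lift (fun (a : Fin (n + 1) → Δ) i => e (a i)) (fun x y hxy => ?_) _ _ hab
      exact ⟨fun i => by rw [hfe], by simpa only [hfe]⟩
    · rintro ⟨a, b, ⟨-, ha⟩, hab, hb⟩
      exact ⟨_, _, ha, ReflTransGen.lift (fun (a : Fin (n + 1) → Δ') i => f (a i))
        (fun x y hxy => hxy.2) _ _ hab, hb⟩

theorem DecidedBy.nlin {Γ Δ : Type*} [Finite Δ] [Nonempty Δ]
    {P : ∀ n : ℕ, (Fin (n + 1) → Γ) → Prop}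
    {I : ∀ n : ℕ, (Fin (n + 1) → Γ) → (Fin (n + 1) → Δ) → Prop}
    {E : ∀ n : ℕ, (Fin (n + 1) → Δ) → (Fin (n + 1) → Δ) → Prop}
    {A : ∀ n : ℕ, (Fin (n + 1) → Δ) → Prop} (h : DecidedBy P I E A) : NLin P := by
  obtain ⟨d, ⟨e⟩⟩ := Finite.exists_equiv_fin Δ
  cases d with
  | zero => exact (e (Classical.arbitrary Δ)).elim0
  | succ d => exact ⟨d, _, _, _, h.recode e e.symm e.symm_apply_apply⟩

section NLin

variable {Γ Δ : Type*} {P Q : ∀ n : ℕ, (Fin (n + 1) → Γ) → Prop}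

theorem NLin.congr (h : NLin P) (hPQ : ∀ n u, Q n u ↔ P n u) : NLin Q := by
  obtain rfl : Q = P := by
    funext n u
    exact propext (hPQ n u)
  exact h

theorem RegPred.nlin (h : RegPred P) : NLin P :=
  DecidedBy.nlin (Δ := Unit) (I := fun n u _ => P n u)
    (E := fun _ _ _ => False)
    (A := fun _ _ => True)
    { init := h.comap Prod.fst
      step := RegPred.const False
      final := RegPred.const True
      iff := fun _ _ => ⟨fun h => ⟨fun _ => (), fun _ => (), h, .refl, trivial⟩,
        fun ⟨_, _, h, _⟩ => h⟩ }

theorem NLin.comap (f : Δ → Γ) (h : NLin P) :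
    NLin fun n (u : Fin (n + 1) → Δ) => P n fun i => f (u i) := by
  obtain ⟨d, I, E, A, h⟩ := h
  exact ⟨d, fun n u a => I n (fun i => f (u i)) a, E, A,
    { init := h.init.comap fun p : Δ × Fin (d + 1) => (f p.1, p.2)
      step := h.step
      final := h.final
      iff := fun n u => h.iff n _ }⟩

/-- A quantified word may be guessed at the start and carried along. -/
theorem NLin.exists {R : ∀ n : ℕ, (Fin (n + 1) → Γ) → (Fin (n + 1) → Δ) → Prop} [Finite Δ]
    (h : NLinRel R) : NLin fun n u => ∃ x, R n u x := by
  obtain ⟨d, I, E, A, h⟩ := h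
  rcases isEmpty_or_nonempty Δ with hΔ | hΔ
  · exact (RegPred.const False).nlin.congr fun n u =>
      ⟨fun ⟨x, _⟩ => hΔ.elim (x 0), False.elim⟩
  refine DecidedBy.nlin (Δ := Fin (d + 1) × Δ)
    (I := fun n u a => I n (fun i => (u i, (a i).2)) fun i => (a i).1)
    (E := fun n a b => E n (fun i => (a i).1) fun i => (b i).1)
    (A := fun n b => A n fun i => (b i).1)
    { init := h.init.comap fun p : Γ × (Fin (d + 1) × Δ) => ((p.1, p.2.2), p.2.1)
      step := h.step.comap fun p : (Fin (d + 1) × Δ) × (Fin (d + 1) × Δ) => (p.1.1, p.2.1)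
      final := h.final.comap Prod.fst
      iff := fun n u => ?_ }
  constructor
  · rintro ⟨x, hx⟩
    obtain ⟨a, b, ha, hab, hb⟩ := (h.iff n fun i => (u i, x i)).1 hx
    refine ⟨fun i => (a i, x i), fun i => (b i, x i), ha, ?_, hb⟩
    exact ReflTransGen.lift (fun (a : Fin (n + 1) → Fin (d + 1)) i => (a i, x i))
      (fun _ _ h => h) _ _ hab
  · rintro ⟨a, b, ha, hab, hb⟩
    exact ⟨fun i => (a i).2, (h.iff n fun i => (u i, (a i).2)).2 ⟨_, _, ha,
      ReflTransGen.lift (fun (a : Fin (n + 1) → Fin (d + 1) × Δ) i => (a i).1)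
        (fun _ _ h => h) _ _ hab, hb⟩⟩

/-- Asynchronous product of two graphs: a path in the product is a pair of paths. -/
theorem reflTransGen_prod_iff {α β : Type*} {r : α → α → Prop} {s : β → β → Prop}
    {p q : α × β} : ReflTransGen (fun x y : α × β => (r x.1 y.1 ∧ x.2 = y.2) ∨
      (x.1 = y.1 ∧ s x.2 y.2)) p q ↔ ReflTransGen r p.1 q.1 ∧ ReflTransGen s p.2 q.2 := by
  constructor
  · intro h
    induction h with
    | refl => exact ⟨.refl, .refl⟩
    | tail _ h ih =>
      rcases h with ⟨h, e⟩ | ⟨e, h⟩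
      · exact ⟨ih.1.tail h, e ▸ ih.2⟩
      · exact ⟨e ▸ ih.1, ih.2.tail h⟩
  · rintro ⟨h1, h2⟩
    obtain ⟨p1, p2⟩ := p
    obtain ⟨q1, q2⟩ := q
    exact (ReflTransGen.lift (fun x => (x, p2)) (fun x y h => Or.inl ⟨h, rfl⟩) _ _ h1).trans
      (ReflTransGen.lift (fun y => (q1, y)) (fun x y h => Or.inr ⟨rfl, h⟩) _ _ h2)

/-- The asynchronous product of two step relations between words: a step moves one of the two
tracks and keeps the other. -/
def prodStep {α β : Type*} {n : ℕ} (r : (Fin (n + 1) → α) → (Fin (n + 1) → α) → Prop)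
    (s : (Fin (n + 1) → β) → (Fin (n + 1) → β) → Prop) (x y : Fin (n + 1) → α × β) : Prop :=
  (r (fun i => (x i).1) (fun i => (y i).1) ∧ (fun i => (x i).2) = fun i => (y i).2) ∨
    ((fun i => (x i).1) = (fun i => (y i).1) ∧ s (fun i => (x i).2) fun i => (y i).2)

theorem reflTransGen_prodStep_iff {α β : Type*} {n : ℕ}
    {r : (Fin (n + 1) → α) → (Fin (n + 1) → α) → Prop}
    {s : (Fin (n + 1) → β) → (Fin (n + 1) → β) → Prop} {p q : Fin (n + 1) → α × β} :
    ReflTransGen (prodStep r s) p q ↔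
      ReflTransGen r (fun i => (p i).1) (fun i => (q i).1) ∧
        ReflTransGen s (fun i => (p i).2) (fun i => (q i).2) := by
  have h := reflTransGen_prod_iff (r := r) (s := s)
    (p := (fun i => (p i).1, fun i => (p i).2)) (q := (fun i => (q i).1, fun i => (q i).2))
  rw [← h]
  constructor
  · exact fun h => ReflTransGen.lift
      (fun x : Fin (n + 1) → α × β => (fun i => (x i).1, fun i => (x i).2)) (fun _ _ h => h) _ _ h
  · exact fun h => ReflTransGen.lift
      (fun (x : (Fin (n + 1) → α) × (Fin (n + 1) → β)) i => (x.1 i, x.2 i)) (fun _ _ h => h)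
      (fun i => (p i).1, fun i => (p i).2) (fun i => (q i).1, fun i => (q i).2) h

theorem RegRel.prodStep {α β : Type*} {r : ∀ n : ℕ, (Fin (n + 1) → α) → (Fin (n + 1) → α) → Prop}
    {s : ∀ n : ℕ, (Fin (n + 1) → β) → (Fin (n + 1) → β) → Prop} (hr : RegRel r) (hs : RegRel s) :
    RegRel fun n => prodStep (r n) (s n) :=
  ((hr.comap fun p : (α × β) × (α × β) => (p.1.1, p.2.1)).and
    (RegPred.eq (fun p : (α × β) × (α × β) => p.1.2) fun p => p.2.2)).or
  ((RegPred.eq (fun p : (α × β) × (α × β) => p.1.1) fun p => p.2.1).and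
    (hs.comap fun p : (α × β) × (α × β) => (p.1.2, p.2.2)))

theorem NLin.and (hP : NLin P) (hQ : NLin Q) : NLin fun n u => P n u ∧ Q n u := by
  obtain ⟨d, I, E, A, hP⟩ := hP
  obtain ⟨d', I', E', A', hQ⟩ := hQ
  refine DecidedBy.nlin (Δ := Fin (d + 1) × Fin (d' + 1))
    (I := fun n u a => I n u (fun i => (a i).1) ∧ I' n u fun i => (a i).2)
    (E := fun n => prodStep (E n) (E' n))
    (A := fun n b => A n (fun i => (b i).1) ∧ A' n fun i => (b i).2)
    { init := (hP.init.comap fun p : Γ × (Fin (d + 1) × Fin (d' + 1)) => (p.1, p.2.1)).and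
        (hQ.init.comap fun p : Γ × (Fin (d + 1) × Fin (d' + 1)) => (p.1, p.2.2))
      step := hP.step.prodStep hQ.step
      final := (hP.final.comap Prod.fst).and (hQ.final.comap Prod.snd)
      iff := fun n u => ?_ }
  simp only [reflTransGen_prodStep_iff]
  rw [hP.iff, hQ.iff]
  constructor
  · rintro ⟨⟨a, b, h1, h2, h3⟩, a', b', h1', h2', h3'⟩
    exact ⟨fun i => (a i, a' i), fun i => (b i, b' i), ⟨h1, h1'⟩, ⟨h2, h2'⟩, h3, h3'⟩
  · rintro ⟨a, b, ⟨h1, h1'⟩, ⟨h2, h2'⟩, h3, h3'⟩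
    exact ⟨⟨_, _, h1, h2, h3⟩, _, _, h1', h2', h3'⟩

theorem NLin.or (hP : NLin P) (hQ : NLin Q) : NLin fun n u => P n u ∨ Q n u := by
  obtain ⟨d, I, E, A, hP⟩ := hP
  obtain ⟨d', I', E', A', hQ⟩ := hQ
  -- A third track, constantly `true` or constantly `false`, says which disjunct is verified.
  have hflag : ∀ c : Bool, RegPred fun n (x : Fin (n + 1) → Bool) => ∀ i, x i = c :=
    fun c => RegPred.all (· = c)
  have hstep : RegRel fun n (_ _ : Fin (n + 1) → Bool) => False := RegPred.const False
  refine DecidedBy.nlin (Δ := (Fin (d + 1) × Fin (d' + 1)) × Bool)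
    (I := fun n u a => ((∀ i, (a i).2 = true) ∧ I n u (fun i => (a i).1.1)) ∨
      ((∀ i, (a i).2 = false) ∧ I' n u fun i => (a i).1.2))
    (E := fun n => prodStep (prodStep (E n) (E' n)) fun _ _ => False)
    (A := fun n b => ((∀ i, (b i).2 = true) ∧ A n (fun i => (b i).1.1)) ∨
      ((∀ i, (b i).2 = false) ∧ A' n fun i => (b i).1.2))
    { init := (((hflag true).comap fun p : Γ × ((Fin (d + 1) × Fin (d' + 1)) × Bool) =>
          p.2.2).and (hP.init.comap fun p : Γ × ((Fin (d + 1) × Fin (d' + 1)) × Bool) =>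
          (p.1, p.2.1.1))).or
        (((hflag false).comap fun p : Γ × ((Fin (d + 1) × Fin (d' + 1)) × Bool) =>
          p.2.2).and (hQ.init.comap fun p : Γ × ((Fin (d + 1) × Fin (d' + 1)) × Bool) =>
          (p.1, p.2.1.2)))
      step := (hP.step.prodStep hQ.step).prodStep hstep
      final := (((hflag true).comap fun p : (Fin (d + 1) × Fin (d' + 1)) × Bool => p.2).and
          (hP.final.comap fun p => p.1.1)).or
        (((hflag false).comap fun p : (Fin (d + 1) × Fin (d' + 1)) × Bool => p.2).and
          (hQ.final.comap fun p => p.1.2))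
      iff := fun n u => ?_ }
  simp only [reflTransGen_prodStep_iff]
  rw [hP.iff, hQ.iff]
  constructor
  · rintro (⟨a, b, h1, h2, h3⟩ | ⟨a, b, h1, h2, h3⟩)
    · exact ⟨fun i => ((a i, 0), true), fun i => ((b i, 0), true), Or.inl ⟨fun _ => rfl, h1⟩,
        ⟨⟨h2, .refl⟩, .refl⟩, Or.inl ⟨fun _ => rfl, h3⟩⟩
    · exact ⟨fun i => ((0, a i), false), fun i => ((0, b i), false),
        Or.inr ⟨fun _ => rfl, h1⟩, ⟨⟨.refl, h2⟩, .refl⟩, Or.inr ⟨fun _ => rfl, h3⟩⟩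
  · rintro ⟨a, b, h1, ⟨⟨h2, h2'⟩, hf⟩, h3⟩
    have hf' : (fun i => (a i).2) = fun i => (b i).2 := by
      rcases ReflTransGen.cases_head hf with h | ⟨_, h, _⟩
      · exact h
      · exact h.elim
    have hf0 := congrFun hf' 0
    rcases h1 with ⟨ha, h1⟩ | ⟨ha, h1⟩ <;> rcases h3 with ⟨hb, h3⟩ | ⟨hb, h3⟩
    · exact Or.inl ⟨_, _, h1, h2, h3⟩
    · simp [ha, hb] at hf0
    · simp [ha, hb] at hf0
    · exact Or.inr ⟨_, _, h1, h2', h3⟩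

end NLin

/-- Closure under reflexive transitive closure. The new graph alternates between an idle mode, in
which the current word `x` is stored, and a running mode, in which the graph that verifies `R p x y`
is followed for a guessed word `y`; on success `y` becomes the current word. -/
theorem NLin.reflTransGen {Γ X : Type*} [Finite Γ] [Finite X]
    {R : ∀ n : ℕ, (Fin (n + 1) → Γ) → (Fin (n + 1) → X) → (Fin (n + 1) → X) → Prop}
    (h : NLin (Γ := Γ × X × X) fun n w =>
      R n (fun i => (w i).1) (fun i => (w i).2.1) (fun i => (w i).2.2)) :
    NLin (Γ := Γ × X × X) fun n w =>
      ReflTransGen (R n fun i => (w i).1) (fun i => (w i).2.1) (fun i => (w i).2.2) := by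
  obtain ⟨d, I, E, A, h⟩ := h
  by_cases hne : Nonempty (Γ × X × X)
  swap
  · exact (RegPred.const False).nlin.congr fun n u => (hne ⟨u 0⟩).elim
  obtain ⟨⟨γ₀, x₀, -⟩⟩ := hne
  -- The tracks: input, whether the mode is running, current word, guessed word, and work space.
  let Δ := (Γ × X × X) × Bool × X × X × Fin (d + 1)
  have : Nonempty Δ := ⟨(γ₀, x₀, x₀), false, x₀, x₀, 0⟩
  have hmode : ∀ c : Bool, RegPred fun n (x : Fin (n + 1) → Bool) => ∀ i, x i = c :=
    fun c => RegPred.all (· = c)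
  refine DecidedBy.nlin (Δ := Δ)
    (I := fun n u a => (fun i => u i) = (fun i => (a i).1) ∧ (∀ i, (a i).2.1 = false) ∧
      (fun i => (u i).2.1) = fun i => (a i).2.2.1)
    (E := fun n a b => (fun i => (a i).1) = (fun i => (b i).1) ∧
      (((∀ i, (a i).2.1 = false) ∧ (∀ i, (b i).2.1 = true) ∧
          (fun i => (a i).2.2.1) = (fun i => (b i).2.2.1) ∧
          I n (fun i => ((b i).1.1, (b i).2.2.1, (b i).2.2.2.1)) fun i => (b i).2.2.2.2) ∨
        ((∀ i, (a i).2.1 = true) ∧ (∀ i, (b i).2.1 = true) ∧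
          (fun i => (a i).2.2.1) = (fun i => (b i).2.2.1) ∧
          (fun i => (a i).2.2.2.1) = (fun i => (b i).2.2.2.1) ∧
          E n (fun i => (a i).2.2.2.2) fun i => (b i).2.2.2.2) ∨
        ((∀ i, (a i).2.1 = true) ∧ (∀ i, (b i).2.1 = false) ∧
          (fun i => (a i).2.2.2.1) = (fun i => (b i).2.2.1) ∧
          A n fun i => (a i).2.2.2.2)))
    (A := fun n b => (∀ i, (b i).2.1 = false) ∧ (fun i => (b i).2.2.1) = fun i => (b i).1.2.2)
    { init := (RegPred.eq (fun p : (Γ × X × X) × Δ => p.1) fun p => p.2.1).and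
        (((hmode false).comap fun p : (Γ × X × X) × Δ => p.2.2.1).and
          (RegPred.eq (fun p : (Γ × X × X) × Δ => p.1.2.1) fun p => p.2.2.2.1))
      step := (RegPred.eq (fun p : Δ × Δ => p.1.1) fun p => p.2.1).and <|
        (((hmode false).comap fun p : Δ × Δ => p.1.2.1).and <|
          ((hmode true).comap fun p : Δ × Δ => p.2.2.1).and <|
          (RegPred.eq (fun p : Δ × Δ => p.1.2.2.1) fun p => p.2.2.2.1).and <|
          h.init.comap fun p : Δ × Δ =>
            ((p.2.1.1, p.2.2.2.1, p.2.2.2.2.1), p.2.2.2.2.2)).or <|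
        (((hmode true).comap fun p : Δ × Δ => p.1.2.1).and <|
          ((hmode true).comap fun p : Δ × Δ => p.2.2.1).and <|
          (RegPred.eq (fun p : Δ × Δ => p.1.2.2.1) fun p => p.2.2.2.1).and <|
          (RegPred.eq (fun p : Δ × Δ => p.1.2.2.2.1) fun p => p.2.2.2.2.1).and <|
          h.step.comap fun p : Δ × Δ => (p.1.2.2.2.2, p.2.2.2.2.2)).or <|
        ((hmode true).comap fun p : Δ × Δ => p.1.2.1).and <|
          ((hmode false).comap fun p : Δ × Δ => p.2.2.1).and <|
          (RegPred.eq (fun p : Δ × Δ => p.1.2.2.2.1) fun p => p.2.2.2.1).and <|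
          h.final.comap fun p : Δ × Δ => p.1.2.2.2.2
      final := ((hmode false).comap fun p : Δ => p.2.1).and
        (RegPred.eq (fun p : Δ => p.2.2.1) fun p => p.1.2.2)
      iff := fun n u => ?_ }
  constructor
  · intro hu
    suffices hs : ∀ y, ReflTransGen (R n fun i => (u i).1) (fun i => (u i).2.1) y →
        ∃ z : Fin (n + 1) → X, ∃ c : Fin (n + 1) → Fin (d + 1), ReflTransGen _
          (fun i => (u i, false, (u i).2.1, x₀, 0)) (fun i => (u i, false, y i, z i, c i)) by
      obtain ⟨z, c, hzc⟩ := hs _ hu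
      exact ⟨_, _, ⟨rfl, fun _ => rfl, rfl⟩, hzc, fun _ => rfl, rfl⟩
    intro y hy
    induction hy with
    | refl => exact ⟨fun _ => x₀, fun _ => 0, .refl⟩
    | @tail y y' _ hyy ih =>
      obtain ⟨z, c, ih⟩ := ih
      obtain ⟨a, b, ha, hab, hb⟩ := (h.iff n fun i => ((u i).1, y i, y' i)).1 hyy
      refine ⟨y', b, ReflTransGen.tail (b := fun i => (u i, true, y i, y' i, b i))
        (ReflTransGen.trans (ReflTransGen.tail (c := fun i => (u i, true, y i, y' i, a i)) ih ?_)
          (ReflTransGen.lift (fun (c : Fin (n + 1) → Fin (d + 1)) i =>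
            (u i, true, y i, y' i, c i)) ?_ _ _ hab)) ?_⟩
      · exact ⟨rfl, Or.inl ⟨fun _ => rfl, fun _ => rfl, rfl, ha⟩⟩
      · exact fun _ _ h => ⟨rfl, Or.inr (Or.inl ⟨fun _ => rfl, fun _ => rfl, rfl, rfl, h⟩)⟩
      · exact ⟨rfl, Or.inr (Or.inr ⟨fun _ => rfl, fun _ => rfl, rfl, hb⟩)⟩
  · rintro ⟨a, b, ⟨ha1, ha2, ha3⟩, hab, hb1, hb2⟩
    have inv : (fun i => (b i).1) = u ∧
        ReflTransGen (R n fun i => (u i).1) (fun i => (u i).2.1) (fun i => (b i).2.2.1) ∧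
        ((∀ i, (b i).2.1 = true) → ∃ c,
          I n (fun i => ((u i).1, (b i).2.2.1, (b i).2.2.2.1)) c ∧
            ReflTransGen (E n) c fun i => (b i).2.2.2.2) := by
      clear hb1 hb2
      induction hab with
      | refl =>
        refine ⟨ha1.symm, ha3 ▸ .refl, fun hc => ?_⟩
        have := hc 0
        simp [ha2 0] at this
      | @tail b b' _ hbb ih =>
        obtain ⟨ih1, ih2, ih3⟩ := ih
        obtain ⟨h1, h2⟩ := hbb
        have hu : (fun i => (b' i).1) = u := h1.symm.trans ih1
        have hu' : ∀ i, (b' i).1 = u i := congrFun hu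
        refine ⟨hu, ?_⟩
        rcases h2 with ⟨-, -, hx, hI⟩ | ⟨hm, -, hx, hz, hE⟩ | ⟨hm, hm', hx, hA⟩
        · refine ⟨hx ▸ ih2, fun _ => ⟨_, ?_, .refl⟩⟩
          simpa only [hu'] using hI
        · refine ⟨hx ▸ ih2, fun _ => ?_⟩
          obtain ⟨c, hc1, hc2⟩ := ih3 hm
          refine ⟨c, ?_, hc2.tail hE⟩
          have hx' := congrFun hx
          have hz' := congrFun hz
          simpa only [hx', hz'] using hc1
        · obtain ⟨c, hc1, hc2⟩ := ih3 hm
          refine ⟨?_, fun hc => ?_⟩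
          · rw [← hx]
            exact ih2.tail ((h.iff n fun i => ((u i).1, (b i).2.2.1, (b i).2.2.2.1)).2
              ⟨_, _, hc1, hc2, hA⟩)
          · have := hc 0
            simp [hm' 0] at this
    obtain ⟨i1, i2, -⟩ := inv
    rw [hb2] at i2
    have hu' : ∀ i, (b i).1 = u i := congrFun i1
    simpa only [hu'] using i2

/-! ### Inductive counting in a finite graph -/

section Counting

variable {X : Type*}

/-- A bijective numbering of `X` by `0, …, N`, with first element `o` and last element `t`. -/
structure IsNumbering (v : X → ℕ) (N : ℕ) (o t : X) : Prop where
  inj : Function.Injective v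
  le : ∀ x, v x ≤ N
  surj : ∀ k ≤ N, ∃ x, v x = k
  first : v o = 0
  last : v t = N

/-- One step of a walk that enumerates `X` in increasing order and keeps a counter, the second
component. The counter is raised when the element left behind is verified to satisfy `P`, and kept
when it is verified to satisfy `Q`. -/
def countStep (v : X → ℕ) (P Q : X → Prop) (p q : X × X) : Prop :=
  v q.1 = v p.1 + 1 ∧ ((P p.1 ∧ v q.2 = v p.2 + 1) ∨ (Q p.1 ∧ q.2 = p.2))

/-- A complete walk along `X` may end with the counter `c`. The last element of `X` is not
counted. -/
def Count (v : X → ℕ) (o t : X) (P Q : X → Prop) (c : X) : Prop :=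
  ReflTransGen (countStep v P Q) (o, o) (t, c)

variable {v : X → ℕ} {N : ℕ} {o t : X}

theorem IsNumbering.finite (h : IsNumbering v N o t) : Finite X :=
  Finite.of_injective (fun x => (⟨v x, Nat.lt_succ_of_le (h.le x)⟩ : Fin (N + 1)))
    fun x y hxy => h.inj (by simpa using hxy)

theorem IsNumbering.induction (h : IsNumbering v N o t) {p : X → Prop} (h0 : p o)
    (hs : ∀ x y, v y = v x + 1 → p x → p y) (x : X) : p x := by
  suffices H : ∀ k, ∀ x, v x = k → p x from H _ x rfl
  intro k
  induction k with
  | zero =>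
    intro x hx
    rwa [h.inj (hx.trans h.first.symm)]
  | succ k ih =>
    intro x hx
    obtain ⟨y, hy⟩ := h.surj k (by have := h.le x; omega)
    exact hs y x (by omega) (ih y hy)

theorem IsNumbering.ncard_lt_succ_of_pos (h : IsNumbering v N o t) {P : X → Prop} {y : X}
    (hy : P y) : {x | P x ∧ v x < v y + 1}.ncard = {x | P x ∧ v x < v y}.ncard + 1 := by
  have := h.finite
  rw [← Set.ncard_insert_of_notMem (a := y) (by simp)]
  congr 1
  ext x
  simp only [Set.mem_ofPred_eq, Set.mem_insert_iff, Nat.lt_succ_iff_lt_or_eq]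
  constructor
  · rintro ⟨h1, h2 | h2⟩
    · exact Or.inr ⟨h1, h2⟩
    · exact Or.inl (h.inj h2)
  · rintro (rfl | ⟨h1, h2⟩)
    · exact ⟨hy, Or.inr rfl⟩
    · exact ⟨h1, Or.inl h2⟩

theorem IsNumbering.ncard_lt_succ_of_neg (h : IsNumbering v N o t) {P : X → Prop} {y : X}
    (hy : ¬ P y) : {x | P x ∧ v x < v y + 1}.ncard = {x | P x ∧ v x < v y}.ncard := by
  congr 1
  ext x
  simp only [Set.mem_ofPred_eq, Nat.lt_succ_iff_lt_or_eq]
  refine and_congr_right fun hx => or_iff_left fun he => hy ?_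
  rwa [← h.inj he]

theorem IsNumbering.setOf_lt_last (h : IsNumbering v N o t) {P : X → Prop} (ht : ¬ P t) :
    {x | P x ∧ v x < v t} = {x | P x} := by
  ext x
  refine and_iff_left_of_imp fun hx => ?_
  have h1 := h.le x
  have h2 := h.last
  rcases Nat.lt_or_ge (v x) (v t) with h3 | h3
  · exact h3
  · obtain rfl : x = t := h.inj (by omega)
    exact (ht hx).elim

theorem IsNumbering.le_of_walk (h : IsNumbering v N o t) {P Q : X → Prop} {p : X × X}
    (hp : ReflTransGen (countStep v P Q) (o, o) p) : v p.2 ≤ {x | P x ∧ v x < v p.1}.ncard := by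
  induction hp with
  | refl => simp [h.first]
  | @tail p q _ hpq ih =>
    obtain ⟨h1, ⟨h2, h3⟩ | ⟨h2, h3⟩⟩ := hpq
    · rw [h1, h.ncard_lt_succ_of_pos h2]
      omega
    · rw [h1, h3]
      by_cases hP : P p.1
      · rw [h.ncard_lt_succ_of_pos hP]
        omega
      · rwa [h.ncard_lt_succ_of_neg hP]

theorem IsNumbering.ge_of_walk (h : IsNumbering v N o t) {P Q : X → Prop}
    (hPQ : ∀ x, Q x → ¬ P x) {p : X × X}
    (hp : ReflTransGen (countStep v P Q) (o, o) p) : {x | P x ∧ v x < v p.1}.ncard ≤ v p.2 := by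
  induction hp with
  | refl => simp [h.first]
  | @tail p q _ hpq ih =>
    obtain ⟨h1, ⟨h2, h3⟩ | ⟨h2, h3⟩⟩ := hpq
    · rw [h1, h.ncard_lt_succ_of_pos h2]
      omega
    · rw [h1, h3, h.ncard_lt_succ_of_neg (hPQ _ h2)]
      exact ih

theorem IsNumbering.exists_walk (h : IsNumbering v N o t) {P Q : X → Prop}
    (hPQ : ∀ x, ¬ P x → Q x) (y : X) : ∃ k, v k = {x | P x ∧ v x < v y}.ncard ∧ v k ≤ v y ∧
      ReflTransGen (countStep v P Q) (o, o) (y, k) := by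
  induction y using h.induction with
  | h0 => exact ⟨o, by simp [h.first], le_rfl, .refl⟩
  | hs x y hxy ih =>
    obtain ⟨k, h1, h2, h3⟩ := ih
    rw [hxy]
    by_cases hP : P x
    · obtain ⟨k', hk'⟩ := h.surj (v k + 1) (by have := h.le y; omega)
      exact ⟨k', by rw [h.ncard_lt_succ_of_pos hP]; omega, by omega,
        h3.tail ⟨hxy, Or.inl ⟨hP, hk'⟩⟩⟩
    · exact ⟨k, by rw [h.ncard_lt_succ_of_neg hP]; omega, by omega,
        h3.tail ⟨hxy, Or.inr ⟨hPQ _ hP, rfl⟩⟩⟩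

theorem IsNumbering.le_of_count (h : IsNumbering v N o t) {P Q : X → Prop} {c : X} (ht : ¬ P t)
    (hc : Count v o t P Q c) : v c ≤ {x | P x}.ncard := by
  rw [← h.setOf_lt_last ht]
  exact h.le_of_walk hc

theorem IsNumbering.count_of_eq (h : IsNumbering v N o t) {P Q : X → Prop} {c : X} (ht : ¬ P t)
    (hPQ : ∀ x, ¬ P x → Q x) (hc : v c = {x | P x}.ncard) : Count v o t P Q c := by
  obtain ⟨k, h1, -, h2⟩ := h.exists_walk hPQ t
  rw [h.setOf_lt_last ht, ← hc] at h1
  rwa [h.inj h1] at h2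

theorem IsNumbering.count_iff (h : IsNumbering v N o t) {P Q : X → Prop} {c : X} (ht : ¬ P t)
    (hPQ : ∀ x, Q x ↔ ¬ P x) : Count v o t P Q c ↔ v c = {x | P x}.ncard := by
  refine ⟨fun hc => le_antisymm (h.le_of_count ht hc) ?_,
    h.count_of_eq ht fun x hx => (hPQ x).2 hx⟩
  rw [← h.setOf_lt_last ht]
  exact h.ge_of_walk (fun x hx => (hPQ x).1 hx) hc

theorem IsNumbering.exists_eq_ncard (h : IsNumbering v N o t) {P : X → Prop} (ht : ¬ P t) :
    ∃ c, v c = {x | P x}.ncard := by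
  obtain ⟨k, h1, -⟩ := h.exists_walk (P := P) (Q := fun _ => True) (fun _ _ => trivial) t
  exact ⟨k, h.setOf_lt_last ht ▸ h1⟩

theorem IsNumbering.forall_iff (h : IsNumbering v N o t) {P : X → Prop} :
    (∀ x, P x) ↔ ReflTransGen (fun x y => v y = v x + 1 ∧ P x) o t ∧ P t := by
  constructor
  · intro hP
    exact ⟨h.induction .refl (fun x y hxy hx => hx.tail ⟨hxy, hP x⟩) t, hP t⟩
  · rintro ⟨hw, ht⟩
    have H : ∀ y, ReflTransGen (fun x y => v y = v x + 1 ∧ P x) o y → ∀ x, v x < v y → P x := by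
      intro y hy
      induction hy with
      | refl => intro x hx; rw [h.first] at hx; omega
      | @tail y z _ hyz ih =>
        intro x hx
        rcases Nat.lt_or_ge (v x) (v y) with hlt | hge
        · exact ih x hlt
        · obtain rfl : x = y := h.inj (by omega)
          exact hyz.2
    intro x
    rcases Nat.lt_or_ge (v x) (v t) with hlt | hge
    · exact H t hw x hlt
    · have h1 := h.le x
      have h2 := h.last
      obtain rfl : x = t := h.inj (by omega)
      exact ht

/-- The set of vertices that are reached from `I` by at most `k` steps in `E`. -/
def layer (I : X → Prop) (E : X → X → Prop) : ℕ → Set X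
  | 0 => {x | I x}
  | k + 1 => {x | x ∈ layer I E k ∨ ∃ y ∈ layer I E k, E y x}

/-- A guessed path shows that `x` belongs to the layer with number `v i`. -/
def InLayer (v : X → ℕ) (o : X) (I : X → Prop) (E : X → X → Prop) (i x : X) : Prop :=
  ∃ s, I s ∧ ReflTransGen (fun p q : X × X => v q.1 = v p.1 + 1 ∧ (p.2 = q.2 ∨ E p.2 q.2))
    (o, s) (i, x)

/-- If `c` is the size of the layer with number `v i`, a certificate for `x` not being in that
layer: it consists of `c` elements of the layer different from `x`. -/
def NotInLayer (v : X → ℕ) (o t : X) (I : X → Prop) (E : X → X → Prop) (i c x : X) : Prop :=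
  Count v o t (fun y => InLayer v o I E i y ∧ y ≠ x) (fun _ => True) c

/-- If `c` is the size of the layer with number `v i`, a certificate for `x` not being in the
following layer. -/
def NotInNextLayer (v : X → ℕ) (o t : X) (I : X → Prop) (E : X → X → Prop) (i c x : X) : Prop :=
  ∀ y, (¬ E y x ∧ y ≠ x) ∨ NotInLayer v o t I E i c y

/-- The step from the size of one layer to the size of the following layer. -/
def sizeStep (v : X → ℕ) (o t : X) (I : X → Prop) (E : X → X → Prop) (p q : X × X) : Prop :=
  v q.1 = v p.1 + 1 ∧
    Count v o t (fun x => InLayer v o I E q.1 x) (fun x => NotInNextLayer v o t I E p.1 p.2 x) q.2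

variable {I : X → Prop} {E : X → X → Prop}

theorem layer_subset_succ (k : ℕ) : layer I E k ⊆ layer I E (k + 1) := fun _ hx => Or.inl hx

theorem last_notMem_layer (hI : ¬ I t) (hE : ∀ x, ¬ E x t) (k : ℕ) : t ∉ layer I E k := by
  induction k with
  | zero => exact hI
  | succ k ih =>
    rintro (h | ⟨y, -, h⟩)
    · exact ih h
    · exact hE y h

theorem IsNumbering.inLayer_iff (h : IsNumbering v N o t) (i x : X) :
    InLayer v o I E i x ↔ x ∈ layer I E (v i) := by
  constructor
  · rintro ⟨s, hs, hp⟩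
    have H : ∀ p : X × X, ReflTransGen
        (fun p q : X × X => v q.1 = v p.1 + 1 ∧ (p.2 = q.2 ∨ E p.2 q.2)) (o, s) p →
        p.2 ∈ layer I E (v p.1) := by
      intro p hp
      induction hp with
      | refl => rw [h.first]; exact hs
      | @tail p q _ hpq ih =>
        rw [hpq.1]
        rcases hpq.2 with he | he
        · exact Or.inl (he ▸ ih)
        · exact Or.inr ⟨_, ih, he⟩
    exact H _ hp
  · induction i using h.induction generalizing x with
    | h0 =>
      intro hx
      rw [h.first] at hx
      exact ⟨x, hx, .refl⟩
    | hs i j hij ih =>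
      intro hx
      rw [hij] at hx
      rcases hx with hx | ⟨y, hy, hx⟩
      · obtain ⟨s, hs, hp⟩ := ih x hx
        exact ⟨s, hs, hp.tail ⟨hij, Or.inl rfl⟩⟩
      · obtain ⟨s, hs, hp⟩ := ih y hy
        exact ⟨s, hs, hp.tail ⟨hij, Or.inr hx⟩⟩

theorem IsNumbering.notInLayer_iff (h : IsNumbering v N o t) (hI : ¬ I t) (hE : ∀ x, ¬ E x t)
    {i c : X} (hc : v c = (layer I E (v i)).ncard) (x : X) :
    NotInLayer v o t I E i c x ↔ x ∉ layer I E (v i) := by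
  have := h.finite
  have ht : ¬ (InLayer v o I E i t ∧ t ≠ x) := by
    rw [h.inLayer_iff]
    exact fun h => last_notMem_layer hI hE _ h.1
  have hset : {y | InLayer v o I E i y ∧ y ≠ x} = layer I E (v i) \ {x} := by
    ext y
    simp [h.inLayer_iff]
  constructor
  · intro hx hmem
    have h1 := h.le_of_count ht hx
    rw [hset, hc] at h1
    exact absurd (Set.ncard_sdiff_singleton_lt_of_mem hmem) (by omega)
  · intro hx
    refine h.count_of_eq ht (fun _ _ => trivial) ?_
    rw [hset, hc, Set.sdiff_singleton_eq_self hx]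

theorem IsNumbering.notInNextLayer_iff (h : IsNumbering v N o t) (hI : ¬ I t)
    (hE : ∀ x, ¬ E x t) {i c : X} (hc : v c = (layer I E (v i)).ncard) (x : X) :
    NotInNextLayer v o t I E i c x ↔ x ∉ layer I E (v i + 1) := by
  simp only [NotInNextLayer, h.notInLayer_iff hI hE hc]
  constructor
  · rintro hx (hmem | ⟨y, hy, hyx⟩)
    · rcases hx x with h | h
      · exact h.2 rfl
      · exact h hmem
    · rcases hx y with h | h
      · exact h.1 hyx
      · exact h hy
  · intro hx y
    by_cases hy : y ∈ layer I E (v i)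
    · refine Or.inl ⟨fun he => hx (Or.inr ⟨y, hy, he⟩), ?_⟩
      rintro rfl
      exact hx (Or.inl hy)
    · exact Or.inr hy

theorem IsNumbering.count_inLayer_iff (h : IsNumbering v N o t) (hI : ¬ I t)
    (hE : ∀ x, ¬ E x t) {i c j d : X} (hc : v c = (layer I E (v i)).ncard) (hj : v j = v i + 1) :
    Count v o t (fun x => InLayer v o I E j x) (fun x => NotInNextLayer v o t I E i c x) d ↔
      v d = (layer I E (v j)).ncard := by
  have ht : ¬ InLayer v o I E j t := by
    rw [h.inLayer_iff]
    exact last_notMem_layer hI hE _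
  rw [h.count_iff ht fun x => by
    rw [h.inLayer_iff, h.notInNextLayer_iff hI hE hc, hj]]
  simp only [h.inLayer_iff]
  rfl

theorem IsNumbering.size_iff (h : IsNumbering v N o t) (hI : ¬ I t)
    (hE : ∀ x, ¬ E x t) {c : X} (hc : v c = (layer I E 0).ncard) (i d : X) :
    ReflTransGen (sizeStep v o t I E) (o, c) (i, d) ↔ v d = (layer I E (v i)).ncard := by
  constructor
  · intro hp
    have H : ∀ p, ReflTransGen (sizeStep v o t I E) (o, c) p →
        v p.2 = (layer I E (v p.1)).ncard := by
      intro p hp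
      induction hp with
      | refl => rwa [h.first]
      | @tail p q _ hpq ih => exact (h.count_inLayer_iff hI hE ih hpq.1).1 hpq.2
    exact H _ hp
  · induction i using h.induction generalizing d with
    | h0 =>
      intro hd
      rw [h.first, ← hc] at hd
      rw [h.inj hd]
    | hs i j hij ih =>
      intro hd
      obtain ⟨c', hc'⟩ := h.exists_eq_ncard (P := fun x => x ∈ layer I E (v i))
        (last_notMem_layer hI hE _)
      exact (ih c' hc').tail ⟨hij, (h.count_inLayer_iff hI hE hc' hij).2 hd⟩

theorem layer_eq_of_succ_eq {k : ℕ} (hk : layer I E (k + 1) = layer I E k) (m : ℕ) :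
    layer I E (k + m) = layer I E k := by
  induction m with
  | zero => rfl
  | succ m ih =>
    rw [← add_assoc]
    change {x | x ∈ layer I E (k + m) ∨ ∃ y ∈ layer I E (k + m), E y x} = _
    rw [ih]
    exact hk

/-- The layers are constant from number `N` on, since there are only `N` vertices besides `t`. -/
theorem IsNumbering.layer_last (h : IsNumbering v N o t) (hI : ¬ I t) (hE : ∀ x, ¬ E x t) :
    layer I E (N + 1) = layer I E N := by
  have := h.finite
  by_cases hst : ∃ k ≤ N, layer I E (k + 1) = layer I E k
  · obtain ⟨k, hk, hst⟩ := hst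
    obtain ⟨m, rfl⟩ := Nat.exists_eq_add_of_le hk
    rw [add_assoc, layer_eq_of_succ_eq hst, layer_eq_of_succ_eq hst]
  · push Not at hst
    exfalso
    have H : ∀ k ≤ N + 1, k ≤ (layer I E k).ncard := by
      intro k
      induction k with
      | zero => intro _; exact Nat.zero_le _
      | succ k ih =>
        intro hk
        have h1 := ih (by omega)
        have h2 := Set.ncard_lt_ncard
          (LE.le.ssubset_of_ne (layer_subset_succ k) (hst k (by omega)).symm)
        omega
    have h1 := H _ le_rfl
    obtain ⟨c, hc⟩ := h.exists_eq_ncard (P := fun x => x ∈ layer I E (N + 1))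
        (last_notMem_layer hI hE _)
    have h2 := h.le c
    have h3 : v c = (layer I E (N + 1)).ncard := hc
    omega

theorem IsNumbering.mem_layer_last_iff (h : IsNumbering v N o t) (hI : ¬ I t)
    (hE : ∀ x, ¬ E x t) (x : X) : x ∈ layer I E N ↔ ∃ a, I a ∧ ReflTransGen E a x := by
  constructor
  · generalize N = k
    induction k generalizing x with
    | zero => exact fun hx => ⟨x, hx, .refl⟩
    | succ k ih =>
      rintro (hx | ⟨y, hy, hyx⟩)
      · exact ih x hx
      · obtain ⟨a, ha, hay⟩ := ih y hy
        exact ⟨a, ha, hay.tail hyx⟩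
  · rintro ⟨a, ha, hax⟩
    induction hax with
    | refl =>
      have : ∀ k, a ∈ layer I E k := fun k => by
        induction k with
        | zero => exact ha
        | succ k ih => exact Or.inl ih
      exact this N
    | tail _ hyx ih =>
      rw [← h.layer_last hI hE]
      exact Or.inr ⟨_, ih, hyx⟩

/-- Non-reachability is expressed by existential statements and counting walks only: the sizes of
the successive layers are computed along a walk, and the last size certifies that no vertex with
property `A` is reachable. -/
theorem IsNumbering.not_reachable_iff (h : IsNumbering v N o t) (hI : ¬ I t)
    (hE : ∀ x, ¬ E x t) (A : X → Prop) :
    (¬ ∃ a b, I a ∧ ReflTransGen E a b ∧ A b) ↔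
      ∃ c d, Count v o t I (fun x => ¬ I x) c ∧ ReflTransGen (sizeStep v o t I E) (o, c) (t, d) ∧
        ∀ x, ¬ A x ∨ NotInLayer v o t I E t d x := by
  have hcount : ∀ c, Count v o t I (fun x => ¬ I x) c ↔ v c = (layer I E 0).ncard :=
    fun c => h.count_iff hI fun _ => Iff.rfl
  constructor
  · intro hno
    obtain ⟨c, hc⟩ := h.exists_eq_ncard hI
    obtain ⟨d, hd⟩ := h.exists_eq_ncard (P := fun x => x ∈ layer I E (v t))
        (last_notMem_layer hI hE _)
    refine ⟨c, d, (hcount c).2 hc, (h.size_iff hI hE hc t d).2 hd, fun x => ?_⟩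
    rw [h.notInLayer_iff hI hE hd, h.last, h.mem_layer_last_iff hI hE]
    by_contra! hx
    obtain ⟨hx, a, ha, hax⟩ := hx
    exact hno ⟨a, x, ha, hax, hx⟩
  · rintro ⟨c, d, hc, hd, hA⟩ ⟨a, b, ha, hab, hb⟩
    have hd' := (h.size_iff hI hE ((hcount c).1 hc) t d).1 hd
    have hb' := (hA b).resolve_left (not_not.2 hb)
    rw [h.notInLayer_iff hI hE hd', h.last, h.mem_layer_last_iff hI hE] at hb'
    exact hb' ⟨a, ha, hab⟩

end Counting

/-! ### Complements in nondeterministic linear space -/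

/-- Words over `Fin (B + 1)` are numbered by the numbers that they represent in base `B + 1`. -/
theorem isNumbering_wordVal (B n : ℕ) :
    IsNumbering (fun x : Fin (n + 1) → Fin (B + 1) => (wordVal n x : ℕ)) ((B + 1) ^ (n + 1) - 1)
      (fun _ => 0) (fun _ => Fin.last B) := by
  have hpos : 0 < (B + 1) ^ (n + 1) := by positivity
  have hsurj : ∀ k ≤ (B + 1) ^ (n + 1) - 1,
      ∃ x : Fin (n + 1) → Fin (B + 1), (wordVal n x : ℕ) = k := fun k hk =>
    ⟨finFunctionFinEquiv.symm ⟨k, by omega⟩, by simp [wordVal]⟩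
  have hle : ∀ x : Fin (n + 1) → Fin (B + 1), (wordVal n x : ℕ) ≤ (B + 1) ^ (n + 1) - 1 :=
    fun x => by have := (wordVal n x).isLt; omega
  refine ⟨fun x y h => finFunctionFinEquiv.injective (Fin.ext h), hle, hsurj, ?_, ?_⟩
  · simp [wordVal]
  · obtain ⟨x, hx⟩ := hsurj _ le_rfl
    refine le_antisymm (hle _) (hx ▸ ?_)
    simp only [wordVal, finFunctionFinEquiv_apply]
    exact Finset.sum_le_sum fun i _ => Nat.mul_le_mul_right _ (Nat.lt_succ_iff.1 (x i).isLt)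

/-- Closure under reflexive transitive closure, for relations between pairs of words. -/
theorem NLin.reflTransGen_pair {Γ X Y : Type*} [Finite Γ] [Finite X] [Finite Y]
    {R : ∀ n : ℕ, (Fin (n + 1) → Γ) → (Fin (n + 1) → X) × (Fin (n + 1) → Y) →
      (Fin (n + 1) → X) × (Fin (n + 1) → Y) → Prop}
    (h : NLin (Γ := Γ × (X × Y) × (X × Y)) fun n w => R n (fun i => (w i).1)
      (fun i => (w i).2.1.1, fun i => (w i).2.1.2) (fun i => (w i).2.2.1, fun i => (w i).2.2.2)) :
    NLin (Γ := Γ × (X × Y) × (X × Y)) fun n w => ReflTransGen (R n fun i => (w i).1)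
      (fun i => (w i).2.1.1, fun i => (w i).2.1.2)
      (fun i => (w i).2.2.1, fun i => (w i).2.2.2) := by
  refine (NLin.reflTransGen (X := X × Y) (R := fun n u p q =>
    R n u (fun i => (p i).1, fun i => (p i).2) (fun i => (q i).1, fun i => (q i).2)) h).congr
    fun n u => ⟨fun h => ?_, fun h => ?_⟩
  · exact ReflTransGen.lift
      (fun (x : (Fin (n + 1) → X) × (Fin (n + 1) → Y)) i => (x.1 i, x.2 i)) (fun _ _ h => h)
      (fun i => (u i).2.1.1, fun i => (u i).2.1.2) (fun i => (u i).2.2.1, fun i => (u i).2.2.2) h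
  · exact ReflTransGen.lift
      (fun x : Fin (n + 1) → X × Y => (fun i => (x i).1, fun i => (x i).2)) (fun _ _ h => h) _ _ h

section

variable {Γ : Type*} [Finite Γ] {B : ℕ}

theorem NLin.count {P Q : ∀ n : ℕ, (Fin (n + 1) → Γ) → (Fin (n + 1) → Fin (B + 1)) → Prop}
    (hP : NLinRel P) (hQ : NLinRel Q) :
    NLinRel fun n u (c : Fin (n + 1) → Fin (B + 1)) =>
      Count (fun x => (wordVal n x : ℕ)) (fun _ => 0) (fun _ => Fin.last B) (P n u) (Q n u) c := by
  have hs := (regRel_succ (B + 1)).nlin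
  refine (NLin.reflTransGen_pair (R := fun n u =>
    countStep (fun x => (wordVal n x : ℕ)) (P n u) (Q n u)) ?_).comap
    fun p : Γ × Fin (B + 1) => (p.1, (0, 0), (Fin.last B, p.2))
  let Ω := Γ × (Fin (B + 1) × Fin (B + 1)) × (Fin (B + 1) × Fin (B + 1))
  exact (hs.comap fun p : Ω => (p.2.1.1, p.2.2.1)).and <|
    ((hP.comap fun p : Ω => (p.1, p.2.1.1)).and (hs.comap fun p : Ω => (p.2.1.2, p.2.2.2))).or <|
    (hQ.comap fun p : Ω => (p.1, p.2.1.1)).and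
      (RegPred.eq (fun p : Ω => p.2.2.2) fun p => p.2.1.2).nlin

/-- Closure under universal quantification: all words are checked in the order of their numbers. -/
theorem NLin.forall {P : ∀ n : ℕ, (Fin (n + 1) → Γ) → (Fin (n + 1) → Fin (B + 1)) → Prop}
    (hP : NLinRel P) : NLin fun n u => ∀ x, P n u x := by
  have h := NLin.reflTransGen (Γ := Γ) (X := Fin (B + 1))
    (R := fun n u x y => (wordVal n y : ℕ) = wordVal n x + 1 ∧ P n u x)
    (((regRel_succ (B + 1)).nlin.comap
      fun p : Γ × Fin (B + 1) × Fin (B + 1) => (p.2.1, p.2.2)).and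
      (hP.comap fun p : Γ × Fin (B + 1) × Fin (B + 1) => (p.1, p.2.1)))
  exact ((h.comap fun g : Γ => (g, 0, Fin.last B)).and
    (hP.comap fun g : Γ => (g, Fin.last B))).congr
    fun n u => (isNumbering_wordVal B n).forall_iff

end

/-- The class of properties in nondeterministic linear space is closed under complements. -/
theorem NLin.not {Γ : Type*} [Finite Γ] {P : ∀ n : ℕ, (Fin (n + 1) → Γ) → Prop} (hP : NLin P) :
    NLin fun n u => ¬ P n u := by
  obtain ⟨d, I₀, E₀, A₀, h₀⟩ := hP
  -- A letter is added to the alphabet, so that the last word is not a vertex of the graph.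
  obtain ⟨B, I, E, A, h, hI, hE⟩ : ∃ (B : ℕ)
      (I : ∀ n : ℕ, (Fin (n + 1) → Γ) → (Fin (n + 1) → Fin (B + 1)) → Prop)
      (E : ∀ n : ℕ, (Fin (n + 1) → Fin (B + 1)) → (Fin (n + 1) → Fin (B + 1)) → Prop)
      (A : ∀ n : ℕ, (Fin (n + 1) → Fin (B + 1)) → Prop), DecidedBy P I E A ∧
        (∀ n u, ¬ I n u fun _ => Fin.last B) ∧ ∀ n x, ¬ E n x fun _ => Fin.last B := by
    refine ⟨d + 1, _, _, _, h₀.recode Fin.castSucc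
      (fun a => if h : a = Fin.last (d + 1) then 0 else a.castPred h) (fun a => ?_), ?_, ?_⟩
    · simp [Fin.castSucc_ne_last]
    · intro n u hI
      exact Fin.castSucc_ne_last _ (hI.1 0)
    · intro n x hE
      exact Fin.castSucc_ne_last _ (hE.1 0)
  clear h₀
  have hs := (regRel_succ (B + 1)).nlin
  -- The tracks are the input `u` and the words `i`, `x` in `InLayer … i x`.
  have hlayer : NLin (Γ := Γ × Fin (B + 1) × Fin (B + 1)) fun n w =>
      InLayer (fun x => (wordVal n x : ℕ)) (fun _ => 0) (I n fun i => (w i).1) (E n)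
        (fun i => (w i).2.1) (fun i => (w i).2.2) := by
    refine NLin.exists (Δ := Fin (B + 1))
      (NLin.and (h.init.nlin.comap fun p : (Γ × Fin (B + 1) × Fin (B + 1)) × Fin (B + 1) =>
        (p.1.1, p.2)) ?_)
    refine (NLin.reflTransGen_pair (Γ := Unit) (R := fun n _
      (p q : (Fin (n + 1) → Fin (B + 1)) × (Fin (n + 1) → Fin (B + 1))) =>
        (wordVal n q.1 : ℕ) = wordVal n p.1 + 1 ∧ (p.2 = q.2 ∨ E n p.2 q.2)) ?_).comap
      fun p : (Γ × Fin (B + 1) × Fin (B + 1)) × Fin (B + 1) =>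
        ((), (0, p.2), (p.1.2.1, p.1.2.2))
    let Ω := Unit × (Fin (B + 1) × Fin (B + 1)) × (Fin (B + 1) × Fin (B + 1))
    exact (hs.comap fun p : Ω => (p.2.1.1, p.2.2.1)).and <|
      (RegPred.eq (fun p : Ω => p.2.1.2) fun p => p.2.2.2).nlin.or
      (h.step.nlin.comap fun p : Ω => (p.2.1.2, p.2.2.2))
  have hne : ∀ {Ω : Type _} (f g : Ω → Fin (B + 1)), NLin fun n (w : Fin (n + 1) → Ω) =>
      (fun i => f (w i)) ≠ fun i => g (w i) := fun f g => (RegPred.eq f g).not.nlin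
  -- The tracks are the input `u` and the words `i`, `c`, `x` in `NotInLayer … i c x`.
  have hnot : NLin (Γ := Γ × Fin (B + 1) × Fin (B + 1) × Fin (B + 1)) fun n w =>
      NotInLayer (fun x => (wordVal n x : ℕ)) (fun _ => 0) (fun _ => Fin.last B)
        (I n fun i => (w i).1) (E n) (fun i => (w i).2.1) (fun i => (w i).2.2.1)
        (fun i => (w i).2.2.2) := by
    let Ω := Γ × Fin (B + 1) × Fin (B + 1)
    refine (NLin.count (Γ := Ω) (B := B) (P := fun n w y =>
        InLayer (fun x => (wordVal n x : ℕ)) (fun _ => 0) (I n fun i => (w i).1) (E n)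
          (fun i => (w i).2.1) y ∧ y ≠ fun i => (w i).2.2)
      (Q := fun _ _ _ => True) ?_ (RegPred.const True).nlin).comap
      fun p : Γ × Fin (B + 1) × Fin (B + 1) × Fin (B + 1) =>
        ((p.1, p.2.1, p.2.2.2), p.2.2.1)
    exact (hlayer.comap fun p : Ω × Fin (B + 1) => (p.1.1, p.1.2.1, p.2)).and
      (hne (fun p : Ω × Fin (B + 1) => p.2) fun p => p.1.2.2)
  have hnext : NLin (Γ := Γ × Fin (B + 1) × Fin (B + 1) × Fin (B + 1)) fun n w =>
      NotInNextLayer (fun x => (wordVal n x : ℕ)) (fun _ => 0) (fun _ => Fin.last B)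
        (I n fun i => (w i).1) (E n) (fun i => (w i).2.1) (fun i => (w i).2.2.1)
        (fun i => (w i).2.2.2) := by
    let Ω := (Γ × Fin (B + 1) × Fin (B + 1) × Fin (B + 1)) × Fin (B + 1)
    refine NLin.forall (B := B) (NLin.or (NLin.and ?_ ?_) ?_)
    · exact (h.step.comap fun p : Ω => (p.2, p.1.2.2.2)).not.nlin
    · exact hne (fun p : Ω => p.2) fun p => p.1.2.2.2
    · exact hnot.comap fun p : Ω => (p.1.1, p.1.2.1, p.1.2.2.1, p.2)
  -- The tracks are the input `u` and two pairs, each of a layer number and a layer size.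
  have hsize : NLin (Γ := Γ × (Fin (B + 1) × Fin (B + 1)) × (Fin (B + 1) × Fin (B + 1)))
      fun n w => ReflTransGen (sizeStep (fun x => (wordVal n x : ℕ)) (fun _ => 0)
        (fun _ => Fin.last B) (I n fun i => (w i).1) (E n))
        (fun i => (w i).2.1.1, fun i => (w i).2.1.2)
        (fun i => (w i).2.2.1, fun i => (w i).2.2.2) := by
    let Ω := Γ × (Fin (B + 1) × Fin (B + 1)) × (Fin (B + 1) × Fin (B + 1))
    refine NLin.reflTransGen_pair (R := fun n u => sizeStep (fun x => (wordVal n x : ℕ))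
      (fun _ => 0) (fun _ => Fin.last B) (I n u) (E n)) ?_
    refine (hs.comap fun p : Ω => (p.2.1.1, p.2.2.1)).and ?_
    let Θ := Γ × Fin (B + 1) × Fin (B + 1) × Fin (B + 1)
    refine (NLin.count (Γ := Θ) (B := B) (P := fun n w y =>
        InLayer (fun x => (wordVal n x : ℕ)) (fun _ => 0) (I n fun i => (w i).1) (E n)
          (fun i => (w i).2.2.2) y)
      (Q := fun n w y => NotInNextLayer (fun x => (wordVal n x : ℕ)) (fun _ => 0)
        (fun _ => Fin.last B) (I n fun i => (w i).1) (E n) (fun i => (w i).2.1)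
        (fun i => (w i).2.2.1) y) ?_ ?_).comap
      fun p : Ω => ((p.1, p.2.1.1, p.2.1.2, p.2.2.1), p.2.2.2)
    · exact hlayer.comap fun p : Θ × Fin (B + 1) => (p.1.1, p.1.2.2.2, p.2)
    · exact hnext.comap fun p : Θ × Fin (B + 1) => (p.1.1, p.1.2.1, p.1.2.2.1, p.2)
  refine NLin.congr (P := fun n u => ∃ c d, Count (fun x => (wordVal n x : ℕ)) (fun _ => 0)
      (fun _ => Fin.last B) (I n u) (fun x => ¬ I n u x) c ∧
      ReflTransGen (sizeStep (fun x => (wordVal n x : ℕ)) (fun _ => 0) (fun _ => Fin.last B)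
        (I n u) (E n)) (fun _ => 0, c) (fun _ => Fin.last B, d) ∧
      ∀ x, ¬ A n x ∨ NotInLayer (fun x => (wordVal n x : ℕ)) (fun _ => 0) (fun _ => Fin.last B)
        (I n u) (E n) (fun _ => Fin.last B) d x) ?_ fun n u => ?_
  · let Ω := (Γ × Fin (B + 1)) × Fin (B + 1)
    refine NLin.exists (Δ := Fin (B + 1)) (NLin.exists (Δ := Fin (B + 1)) (NLin.and ?_
      (NLin.and ?_ (NLin.forall (B := B) (NLin.or ?_ ?_)))))
    · exact (NLin.count (Γ := Γ) (P := I) (Q := fun n u x => ¬ I n u x) h.init.nlin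
        h.init.not.nlin).comap fun p : Ω => p.1
    · exact hsize.comap fun p : Ω => (p.1.1, (0, p.1.2), (Fin.last B, p.2))
    · exact (h.final.comap fun p : Ω × Fin (B + 1) => p.2).not.nlin
    · exact hnot.comap fun p : Ω × Fin (B + 1) => (p.1.1.1, Fin.last B, p.1.2, p.2)
  · rw [h.iff]
    exact (isNumbering_wordVal B n).not_reachable_iff (hI n u) (hE n) (A n)

/-! ### From context sensitive grammars to nondeterministic linear space -/

/-- One rewriting step by a rule from `K`. -/
def RewriteStep {α : Type*} (K : Set (List α × List α)) (x y : List α) : Prop :=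
  ∃ p ∈ K, ∃ γ δ : List α, x = γ ++ p.1 ++ δ ∧ y = γ ++ p.2 ++ δ

theorem RewriteStep.append {α : Type*} {K : Set (List α × List α)} {x y : List α}
    (h : RewriteStep K x y) (a b : List α) : RewriteStep K (a ++ x ++ b) (a ++ y ++ b) := by
  obtain ⟨p, hp, γ, δ, rfl, rfl⟩ := h
  exact ⟨p, hp, a ++ γ, δ ++ b, by simp, by simp⟩

theorem RegPred.exists_of_finite {Γ ι : Type*} {K : Set ι} (hK : K.Finite)
    {P : ι → ∀ n : ℕ, (Fin (n + 1) → Γ) → Prop} (h : ∀ i ∈ K, RegPred (P i)) :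
    RegPred fun n u => ∃ i ∈ K, P i n u := by
  induction K, hK using Set.Finite.induction_on with
  | empty => simpa using RegPred.const (Γ := Γ) False
  | insert _ _ ih =>
    exact ((h _ (Set.mem_insert _ _)).or (ih fun i hi => h i (Set.mem_insert_of_mem _ hi))).congr
      fun n u => by simp

theorem regRel_rewriteStep {α : Type*} {K : Set (List α × List α)} (hK : K.Finite)
    (hlen : ∀ p ∈ K, p.1.length = p.2.length) :
    RegRel fun n (a b : Fin (n + 1) → α) => RewriteStep K (List.ofFn a) (List.ofFn b) := by
  refine RegPred.exists_of_finite hK fun p hp => ?_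
  let D : Language (α × α) := {x | ∀ z ∈ x, z.1 = z.2}
  refine ⟨D * {p.1.zip p.2} * D, isRegular_mul (isRegular_mul (isRegular_all _)
    (isRegular_singleton _)) (isRegular_all _), fun n w => ?_⟩
  have hD : ∀ x ∈ D, x.map Prod.fst = x.map Prod.snd := fun x hx =>
    List.map_congr_left fun z hz => hx z hz
  have hD' : ∀ γ : List α, γ.zip γ ∈ D := by
    intro γ
    induction γ with
    | nil => exact fun z hz => (List.not_mem_nil hz).elim
    | cons a γ ih =>
      rintro z hz
      rw [List.zip_cons_cons, List.mem_cons] at hz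
      rcases hz with rfl | hz
      · rfl
      · exact ih z hz
  have h1 : (List.ofFn fun i => (w i).1) = (List.ofFn w).map Prod.fst := by
    rw [List.map_ofFn]; rfl
  have h2 : (List.ofFn fun i => (w i).2) = (List.ofFn w).map Prod.snd := by
    rw [List.map_ofFn]; rfl
  rw [Language.mem_mul]
  constructor
  · rintro ⟨γ, δ, e1, e2⟩
    refine ⟨_, Language.mem_mul.2 ⟨γ.zip γ, hD' γ, p.1.zip p.2, rfl, rfl⟩, δ.zip δ, hD' δ, ?_⟩
    rw [← List.zip_append rfl, ← List.zip_append (by simp [hlen p hp]), ← e1, ← e2]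
    exact (List.zip_of_prod h1.symm h2.symm).symm
  · rintro ⟨xy, hxy, z, hz, e⟩
    obtain ⟨x, hx, y, rfl, rfl⟩ := Language.mem_mul.1 hxy
    refine ⟨x.map Prod.fst, z.map Prod.fst, h1.trans ?_, h2.trans ?_⟩
    · rw [← e, List.map_append, List.map_append, List.map_fst_zip (hlen p hp).le]
    · rw [← e, List.map_append, List.map_append, List.map_snd_zip (hlen p hp).ge, hD x hx, hD z hz]

theorem finite_symbol {T N : Type*} [Finite T] [Finite N] : Finite (Symbol T N) := by
  refine Finite.of_injective (β := T ⊕ N)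
    (fun s => match s with | .terminal t => .inl t | .nonterminal a => .inr a) ?_
  rintro (a | a) (b | b) h <;> simp_all

namespace ContextSensitiveGrammar

variable {T : Type u} (g : ContextSensitiveGrammar T)

/-- The rules of a grammar, made length-preserving by means of a blank symbol `none`. A blank may
move to the left, and blanks next to the left-hand side of a production make room for its
right-hand side. -/
def paddedRules : Set (List (Option (Symbol T g.NT)) × List (Option (Symbol T g.NT))) :=
  (fun r : List (Symbol T g.NT) × List (Symbol T g.NT) =>
    (r.1.map some ++ List.replicate (r.2.length - r.1.length) none, r.2.map some)) '' g.rules ∪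
  Set.range fun x : Symbol T g.NT => ([some x, none], [none, some x])

theorem finite_paddedRules [Finite T] : g.paddedRules.Finite := by
  have := g.finite_NT
  have : Finite (Symbol T g.NT) := finite_symbol
  exact (g.finite_rules.image _).union (Set.finite_range _)

theorem length_of_mem_paddedRules : ∀ p ∈ g.paddedRules, p.1.length = p.2.length := by
  rintro p (⟨r, hr, rfl⟩ | ⟨x, rfl⟩)
  · have := g.length_le r hr
    simp
    omega
  · rfl

/-- Without its blanks, a rewriting by padded rules is a derivation. -/
theorem reduceOption_of_rewriteStep {x y : List (Option (Symbol T g.NT))}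
    (h : RewriteStep g.paddedRules x y) :
    ReflTransGen g.Produces x.reduceOption y.reduceOption := by
  obtain ⟨p, ⟨r, hr, rfl⟩ | ⟨s, rfl⟩, γ, δ, rfl, rfl⟩ := h
  · refine .single ⟨r, hr, γ.reduceOption, δ.reduceOption, ?_, ?_⟩ <;>
      simp [List.reduceOption, List.filterMap_map]
  · simp [List.reduceOption_append, List.reduceOption_cons_of_none,
      List.reduceOption_cons_of_some]
    exact .refl

theorem move_blank (pre post : List (Option (Symbol T g.NT))) (δ : List (Symbol T g.NT)) :
    ReflTransGen (RewriteStep g.paddedRules) (pre ++ δ.map some ++ none :: post)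
      (pre ++ none :: δ.map some ++ post) := by
  induction δ using List.reverseRecOn generalizing post with
  | nil => simp [ReflTransGen.refl]
  | append_singleton δ x ih =>
    refine .head (b := pre ++ δ.map some ++ none :: (some x :: post)) ?_ ?_
    · exact ⟨_, Or.inr ⟨x, rfl⟩, pre ++ δ.map some, post, by simp, by simp⟩
    · simpa using ih (some x :: post)

theorem move_blanks (k : ℕ) (pre post : List (Option (Symbol T g.NT)))
    (δ : List (Symbol T g.NT)) :
    ReflTransGen (RewriteStep g.paddedRules) (pre ++ δ.map some ++ List.replicate k none ++ post)
      (pre ++ List.replicate k none ++ δ.map some ++ post) := by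
  induction k generalizing pre with
  | zero => simp [ReflTransGen.refl]
  | succ k ih =>
    have h1 := g.move_blank pre (List.replicate k none ++ post) δ
    have h2 := ih (pre ++ [none])
    refine ReflTransGen.trans (b := pre ++ none :: δ.map some ++ (List.replicate k none ++ post))
      ?_ ?_
    · simpa [List.replicate_succ] using h1
    · simpa [List.replicate_succ] using h2

/-- The word `x` followed by blanks up to length `N`. -/
def pad (N : ℕ) (x : List (Symbol T g.NT)) : List (Option (Symbol T g.NT)) :=
  x.map some ++ List.replicate (N - x.length) none

theorem length_le_of_produces {x y : List (Symbol T g.NT)} (h : g.Produces x y) :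
    x.length ≤ y.length := by
  obtain ⟨r, hr, γ, δ, rfl, rfl⟩ := h
  have := g.length_le r hr
  simp
  omega

/-- A derivation step is simulated by moving blanks next to the left-hand side and replacing. -/
theorem pad_of_produces {N : ℕ} {x y : List (Symbol T g.NT)} (h : g.Produces x y)
    (hy : y.length ≤ N) : ReflTransGen (RewriteStep g.paddedRules) (g.pad N x) (g.pad N y) := by
  obtain ⟨r, hr, γ, δ, rfl, rfl⟩ := h
  have hle := g.length_le r hr
  have hN : N - (γ ++ r.1 ++ δ).length =
      (r.2.length - r.1.length) + (N - (γ ++ r.2 ++ δ).length) := by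
    simp at hy ⊢
    omega
  have h1 := g.move_blanks (r.2.length - r.1.length) ((γ ++ r.1).map some)
    (List.replicate (N - (γ ++ r.2 ++ δ).length) none) δ
  rw [pad, hN, List.replicate_add]
  refine ReflTransGen.tail (b := _) (by simpa using h1) ?_
  exact ⟨_, Or.inl ⟨r, hr, rfl⟩, γ.map some,
    δ.map some ++ List.replicate (N - (γ ++ r.2 ++ δ).length) none, by simp, by simp [pad]⟩

theorem pad_of_derives {N : ℕ} {x y : List (Symbol T g.NT)} (h : ReflTransGen g.Produces x y)
    (hy : y.length ≤ N) : ReflTransGen (RewriteStep g.paddedRules) (g.pad N x) (g.pad N y) := by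
  induction h with
  | refl => exact .refl
  | tail _ h ih => exact (ih ((g.length_le_of_produces h).trans hy)).trans (g.pad_of_produces h hy)

/-- The words generated by a context sensitive grammar are recognised in nondeterministic linear
space, by undoing derivation steps. -/
theorem nlin_language [Finite T] :
    NLin fun n (u : Fin (n + 1) → T) => List.ofFn u ∈ g.language := by
  have := g.finite_NT
  have : Finite (Symbol T g.NT) := finite_symbol
  have hlen : ∀ {x y}, RewriteStep g.paddedRules x y → x.length = y.length := by
    rintro x y ⟨p, hp, γ, δ, rfl, rfl⟩
    simp [g.length_of_mem_paddedRules p hp]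
  let D : Language (Option (Symbol T g.NT)) := {x | ∀ z ∈ x, z = none}
  refine DecidedBy.nlin (Δ := Option (Symbol T g.NT))
    (I := fun n u a => (fun i => some (Symbol.terminal (u i))) = fun i => a i)
    (E := fun n a b => RewriteStep g.paddedRules (List.ofFn b) (List.ofFn a))
    (A := fun n b => List.ofFn b ∈ ({[some (Symbol.nonterminal g.start)]} : Language _) * D)
    { init := RegPred.eq (fun p : T × Option (Symbol T g.NT) => some (Symbol.terminal p.1)) Prod.snd
      step := RegPred.comap (fun p : Option (Symbol T g.NT) × Option (Symbol T g.NT) => (p.2, p.1))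
        (regRel_rewriteStep g.finite_paddedRules g.length_of_mem_paddedRules)
      final := ⟨_, isRegular_mul (isRegular_singleton _) (isRegular_all _), fun _ _ => Iff.rfl⟩
      iff := fun n u => ?_ }
  constructor
  · intro hu
    have h1 := g.pad_of_derives (N := n + 1) hu (by simp)
    have h2 : g.pad (n + 1) ((List.ofFn u).map Symbol.terminal) =
        List.ofFn fun i => some (Symbol.terminal (u i)) := by
      simp [pad, List.map_ofFn]
      rfl
    have H : ∀ x y, ReflTransGen (RewriteStep g.paddedRules) x y →
        ∀ a : Fin (n + 1) → Option (Symbol T g.NT), y = List.ofFn a →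
        ∃ b, x = List.ofFn b ∧ ReflTransGen
          (fun a b : Fin (n + 1) → Option (Symbol T g.NT) =>
            RewriteStep g.paddedRules (List.ofFn b) (List.ofFn a)) a b := by
      intro x y hxy
      induction hxy with
      | refl => exact fun a ha => ⟨a, ha, .refl⟩
      | @tail y z _ hyz ih =>
        intro a ha
        have hy : y.length = n + 1 := by rw [hlen hyz, ha, List.length_ofFn]
        obtain ⟨c, hc⟩ : ∃ c : Fin (n + 1) → Option (Symbol T g.NT), y = List.ofFn c := by
          refine ⟨fun i => y[(i : ℕ)], List.ext_getElem (by simp [hy]) fun i h1 h2 => ?_⟩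
          rw [List.getElem_ofFn]
        obtain ⟨b, hb, hcb⟩ := ih c hc
        exact ⟨b, hb, .head (hc ▸ ha ▸ hyz) hcb⟩
    obtain ⟨b, hb, hab⟩ := H _ _ h1 _ h2
    refine ⟨_, b, rfl, hab, ?_⟩
    rw [← hb, Language.mem_mul]
    refine ⟨_, rfl, List.replicate n none, fun z hz => List.eq_of_mem_replicate hz, ?_⟩
    simp [pad]
  · rintro ⟨a, b, ha, hab, hb⟩
    obtain rfl : a = fun i => some (Symbol.terminal (u i)) := ha.symm
    have h1 : ReflTransGen g.Produces (List.ofFn b).reduceOption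
        (List.ofFn fun i => some (Symbol.terminal (u i))).reduceOption := by
      clear hb
      induction hab with
      | refl => exact .refl
      | tail _ h ih => exact (g.reduceOption_of_rewriteStep h).trans ih
    have h2 : (List.ofFn b).reduceOption = [Symbol.nonterminal g.start] := by
      obtain ⟨x, rfl, y, hy, e⟩ := Language.mem_mul.1 hb
      rw [← e]
      have : y.reduceOption = [] := by
        rw [List.reduceOption, List.filterMap_eq_nil_iff]
        exact hy
      simp [this]
    have h3 : (List.ofFn fun i => some (Symbol.terminal (N := g.NT) (u i))).reduceOption =
        (List.ofFn u).map Symbol.terminal := by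
      have : (List.ofFn fun i => some (Symbol.terminal (N := g.NT) (u i))) =
          (List.ofFn u).map (some ∘ Symbol.terminal) := by
        rw [List.map_ofFn]; rfl
      rw [this, List.reduceOption, List.filterMap_map]
      simp [Function.comp_def]
    rw [h2, h3] at h1
    exact h1

end ContextSensitiveGrammar

/-! ### From nondeterministic linear space to context sensitive grammars -/

/-- A cell of the tape of the simulated machine: the input letter `sym`, the current letter `val`,
and flags that say whether the cell is the first or the last cell. -/
structure Cell (T : Type u) (Δ : Type) where
  sym : T
  val : Δ
  first : Bool
  last : Bool

/-- The nonterminals of the simulating grammar. Apart from plain cells there are those that carry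
the head of the machine: `gen` creates the tape, `back` moves to the left end, `sweep` moves to the
right while replacing the current word by a word related to it, and `check` moves to the right
while verifying the final property and releasing the input letters. -/
inductive SimNT (T : Type u) (Δ σI σE σA : Type) : Type u
  | gen (q : σI) (first : Bool)
  | cell (c : Cell T Δ)
  | back (c : Cell T Δ)
  | sweep (q : σE) (c : Cell T Δ)
  | check (q : σA) (c : Cell T Δ)

theorem finite_cell {T : Type u} {Δ : Type} [Finite T] [Finite Δ] : Finite (Cell T Δ) := by
  refine Finite.of_injective (β := T × Δ × Bool × Bool)
    (fun c => (c.sym, c.val, c.first, c.last)) ?_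
  rintro ⟨⟩ ⟨⟩ h
  simpa using h

theorem finite_simNT {T : Type u} {Δ σI σE σA : Type} [Finite T] [Finite Δ] [Finite σI]
    [Finite σE] [Finite σA] : Finite (SimNT T Δ σI σE σA) := by
  have : Finite (Cell T Δ) := finite_cell
  refine Finite.of_injective (β := (σI × Bool) ⊕ Cell T Δ ⊕ Cell T Δ ⊕ (σE × Cell T Δ) ⊕
      (σA × Cell T Δ))
    (fun s => match s with
      | .gen q f => .inl (q, f)
      | .cell c => .inr (.inl c)
      | .back c => .inr (.inr (.inl c))
      | .sweep q c => .inr (.inr (.inr (.inl (q, c))))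
      | .check q c => .inr (.inr (.inr (.inr (q, c))))) ?_
  rintro (_ | _ | _ | _ | _) (_ | _ | _ | _ | _) h <;> simp_all

section Simulation

open Symbol SimNT

variable {T : Type u} {Δ σI σE σA : Type} (MI : DFA (T × Δ) σI) (ME : DFA (Δ × Δ) σE)
  (MA : DFA Δ σA)

/-- The productions of the simulating grammar. -/
inductive SimRule : List (Symbol T (SimNT T Δ σI σE σA)) →
    List (Symbol T (SimNT T Δ σI σE σA)) → Prop
  | gen (q f t a) : SimRule [nonterminal (gen q f)]
      [nonterminal (cell ⟨t, a, f, false⟩), nonterminal (gen (MI.step q (t, a)) false)]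
  | genEnd (q f t a) (h : MI.step q (t, a) ∈ MI.accept) : SimRule [nonterminal (gen q f)]
      [nonterminal (back ⟨t, a, f, true⟩)]
  | back (c c') : SimRule [nonterminal (cell c), nonterminal (back c')]
      [nonterminal (back c), nonterminal (cell c')]
  | sweepStart (c) (h : c.first = true) : SimRule [nonterminal (back c)]
      [nonterminal (sweep ME.start c)]
  | sweep (q c c' b) : SimRule [nonterminal (sweep q c), nonterminal (cell c')]
      [nonterminal (cell { c with val := b }), nonterminal (sweep (ME.step q (c.val, b)) c')]
  | sweepEnd (q c b) (h : c.last = true) (h' : ME.step q (c.val, b) ∈ ME.accept) :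
      SimRule [nonterminal (sweep q c)] [nonterminal (back { c with val := b })]
  | checkStart (c) (h : c.first = true) : SimRule [nonterminal (back c)]
      [nonterminal (check MA.start c)]
  | check (q c c') : SimRule [nonterminal (check q c), nonterminal (cell c')]
      [terminal c.sym, nonterminal (check (MA.step q c.val) c')]
  | checkEnd (q c) (h : c.last = true) (h' : MA.step q c.val ∈ MA.accept) :
      SimRule [nonterminal (check q c)] [terminal c.sym]

/-- The grammar that simulates the machine given by the three automata. -/
def simGrammar [Finite T] [Finite Δ] [Finite σI] [Finite σE] [Finite σA] :
    ContextSensitiveGrammar T where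
  NT := SimNT T Δ σI σE σA
  finite_NT := finite_simNT
  start := gen MI.start true
  rules := {r | SimRule MI ME MA r.1 r.2}
  finite_rules := by
    have : Finite (SimNT T Δ σI σE σA) := finite_simNT
    have : Finite (Symbol T (SimNT T Δ σI σE σA)) := finite_symbol
    refine ((List.finite_length_le _ 2).prod (List.finite_length_le _ 2)).subset ?_
    rintro ⟨x, y⟩ h
    change SimRule MI ME MA x y at h
    cases h <;> exact ⟨by simp, by simp⟩
  lhs_ne_nil := by
    rintro ⟨x, y⟩ h
    change SimRule MI ME MA x y at h
    cases h <;> simp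
  length_le := by
    rintro ⟨x, y⟩ h
    change SimRule MI ME MA x y at h
    cases h <;> simp

/-- The machine step: replacing a word by a word of the same length that is related to it. -/
def machineStep (v v' : List Δ) : Prop := v.length = v'.length ∧ v.zip v' ∈ ME.accepts

/-- The word `v` is a reachable state of the machine on input `w`. -/
def Reached (w : List T) (v : List Δ) : Prop :=
  ∃ v₀, v₀.length = w.length ∧ w.zip v₀ ∈ MI.accepts ∧ ReflTransGen (machineStep ME) v₀ v

/-- The pair of flags of a cell. -/
def Cell.flags (c : Cell T Δ) : Bool × Bool := (c.first, c.last)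

/-- In the flags of a complete tape, only the first and the last cell may be marked as such. -/
def TapeFlags (l : List (Bool × Bool)) : Prop :=
  ∀ p₁ c p₂, l = p₁ ++ c :: p₂ → (c.1 = true → p₁ = []) ∧ (c.2 = true → p₂ = [])

/-- In the flags of an unfinished tape, only the first cell may be marked. -/
def GenFlags (l : List (Bool × Bool)) : Prop :=
  ∀ p₁ c p₂, l = p₁ ++ c :: p₂ → (c.1 = true → p₁ = []) ∧ c.2 = false

theorem GenFlags.snoc {l : List (Bool × Bool)} (h : GenFlags l) {f : Bool}
    (hf : f = true → l = []) : GenFlags (l ++ [(f, false)]) := by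
  intro p₁ c p₂ he
  rcases List.eq_nil_or_concat p₂ with rfl | ⟨p₂, d, rfl⟩
  · obtain ⟨rfl, hc⟩ := List.append_inj' he rfl
    cases hc
    exact ⟨hf, rfl⟩
  · rw [List.concat_eq_append, ← List.cons_append, ← List.append_assoc] at he
    exact h p₁ c p₂ (List.append_inj' he rfl).1

theorem GenFlags.tapeFlags {l : List (Bool × Bool)} (h : GenFlags l) {f : Bool}
    (hf : f = true → l = []) : TapeFlags (l ++ [(f, true)]) := by
  intro p₁ c p₂ he
  rcases List.eq_nil_or_concat p₂ with rfl | ⟨p₂, d, rfl⟩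
  · obtain ⟨rfl, hc⟩ := List.append_inj' he rfl
    cases hc
    exact ⟨hf, fun _ => rfl⟩
  · rw [List.concat_eq_append, ← List.cons_append, ← List.append_assoc] at he
    have := h p₁ c p₂ (List.append_inj' he rfl).1
    exact ⟨this.1, fun h => by simp [this.2] at h⟩

theorem TapeFlags.eq_nil_left {pre post : List (Cell T Δ)} {c : Cell T Δ}
    (h : TapeFlags ((pre ++ c :: post).map Cell.flags)) (hc : c.first = true) : pre = [] := by
  simpa using (h (pre.map Cell.flags) c.flags (post.map Cell.flags) (by simp)).1 hc

theorem TapeFlags.eq_nil_right {pre post : List (Cell T Δ)} {c : Cell T Δ}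
    (h : TapeFlags ((pre ++ c :: post).map Cell.flags)) (hc : c.last = true) : post = [] := by
  simpa using (h (pre.map Cell.flags) c.flags (post.map Cell.flags) (by simp)).2 hc

/-- The sentential forms of the simulating grammar. During creation of the tape, the state of the
head is that of the initial automaton after the cells created so far. When the head moves back, the
tape holds a reachable state of the machine. During a sweep, the cells to the left of the head have
already been overwritten, and `v` is their former contents. During the final check, the cells to the
left of the head have been replaced by their input letters. -/
inductive SimForm : List (Symbol T (SimNT T Δ σI σE σA)) → Prop
  | gen (pre : List (Cell T Δ)) (q f) (hq : q = MI.eval (pre.map fun c => (c.sym, c.val)))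
      (hf : f = true → pre = [])
      (hflag : GenFlags (pre.map Cell.flags)) :
      SimForm (pre.map (fun c => nonterminal (cell c)) ++ nonterminal (gen q f) :: [])
  | back (pre c post) (hflag : TapeFlags ((pre ++ c :: post).map Cell.flags))
      (h : Reached MI ME ((pre ++ c :: post).map Cell.sym) ((pre ++ c :: post).map Cell.val)) :
      SimForm (pre.map (fun c => nonterminal (cell c)) ++ nonterminal (back c) ::
        post.map fun c => nonterminal (cell c))
  | sweep (pre c post v q) (hflag : TapeFlags ((pre ++ c :: post).map Cell.flags))
      (hv : v.length = pre.length)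
      (hq : q = ME.eval (v.zip (pre.map Cell.val)))
      (h : Reached MI ME ((pre ++ c :: post).map Cell.sym) (v ++ (c :: post).map Cell.val)) :
      SimForm (pre.map (fun c => nonterminal (cell c)) ++ nonterminal (sweep q c) ::
        post.map fun c => nonterminal (cell c))
  | check (pre c post q) (hflag : TapeFlags ((pre ++ c :: post).map Cell.flags))
      (hq : q = MA.eval (pre.map Cell.val))
      (h : Reached MI ME ((pre ++ c :: post).map Cell.sym) ((pre ++ c :: post).map Cell.val)) :
      SimForm (pre.map (fun c => terminal c.sym) ++ nonterminal (check q c) ::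
        post.map fun c => nonterminal (cell c))
  | done (w : List T) (v) (h : Reached MI ME w v) (h' : v ∈ MA.accepts) :
      SimForm (w.map terminal)

/-- The symbols that carry the head. -/
def IsHead : Symbol T (SimNT T Δ σI σE σA) → Prop
  | terminal _ => False
  | nonterminal (cell _) => False
  | _ => True

theorem eq_of_append_cons_eq {α : Type*} {p : α → Prop} {a b c d : List α} {x y : α}
    (h : a ++ x :: b = c ++ y :: d) (ha : ∀ z ∈ a, ¬ p z) (hb : ∀ z ∈ b, ¬ p z) (hy : p y) :
    a = c ∧ x = y ∧ b = d := by
  rcases List.append_eq_append_iff.1 h with ⟨e, rfl, h'⟩ | ⟨e, rfl, h'⟩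
  · cases e with
    | nil => simpa using h'
    | cons z e =>
      have : b = e ++ y :: d := (List.cons.inj h').2
      exact (hb y (by simp [this]) hy).elim
  · cases e with
    | nil => simpa [eq_comm] using h'
    | cons z e => exact (ha y (by simp [(List.cons.inj h').1]) hy).elim

theorem not_isHead_of_mem_cells {L : List (Cell T Δ)} :
    ∀ z ∈ L.map (fun c => (nonterminal (cell c) : Symbol T (SimNT T Δ σI σE σA))), ¬ IsHead z := by
  intro z hz
  obtain ⟨c, -, rfl⟩ := List.mem_map.1 hz
  exact id

theorem not_isHead_of_mem_terminals {α : Type*} {f : α → T} {L : List α} :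
    ∀ z ∈ L.map (fun c => (terminal (f c) : Symbol T (SimNT T Δ σI σE σA))), ¬ IsHead z := by
  intro z hz
  obtain ⟨c, -, rfl⟩ := List.mem_map.1 hz
  exact id

variable {MI ME MA}

theorem simForm_gen_inv {A B : List (Symbol T (SimNT T Δ σI σE σA))} {q : σI} {f : Bool}
    (h : SimForm MI ME MA (A ++ nonterminal (gen q f) :: B)) : ∃ pre : List (Cell T Δ),
      A = pre.map (fun c => nonterminal (cell c)) ∧ B = [] ∧
      q = MI.eval (pre.map fun c => (c.sym, c.val)) ∧ (f = true → pre = []) ∧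
      GenFlags (pre.map Cell.flags) := by
  generalize hz : A ++ nonterminal (gen q f) :: B = z at h
  cases h with
  | gen pre q' f' hq hf hflag =>
    obtain ⟨rfl, h, rfl⟩ := eq_of_append_cons_eq (p := IsHead) hz.symm not_isHead_of_mem_cells
      (by simp) (by exact trivial)
    cases h
    exact ⟨pre, rfl, rfl, hq, hf, hflag⟩
  | back pre c post hflag h =>
    cases (eq_of_append_cons_eq (p := IsHead) hz.symm not_isHead_of_mem_cells
      not_isHead_of_mem_cells (by exact trivial)).2.1
  | sweep pre c post v q hflag hv hq h =>
    cases (eq_of_append_cons_eq (p := IsHead) hz.symm not_isHead_of_mem_cells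
      not_isHead_of_mem_cells (by exact trivial)).2.1
  | check pre c post q hflag hq h =>
    cases (eq_of_append_cons_eq (p := IsHead) hz.symm not_isHead_of_mem_terminals
      not_isHead_of_mem_cells (by exact trivial)).2.1
  | done w v h h' =>
    have := congrArg (nonterminal (gen q f) ∈ ·) hz
    simp at this

theorem simForm_back_inv {A B : List (Symbol T (SimNT T Δ σI σE σA))} {c : Cell T Δ}
    (h : SimForm MI ME MA (A ++ nonterminal (back c) :: B)) : ∃ pre post : List (Cell T Δ),
      A = pre.map (fun c => nonterminal (cell c)) ∧
      B = post.map (fun c => nonterminal (cell c)) ∧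
      TapeFlags ((pre ++ c :: post).map Cell.flags) ∧
      Reached MI ME ((pre ++ c :: post).map Cell.sym) ((pre ++ c :: post).map Cell.val) := by
  generalize hz : A ++ nonterminal (back c) :: B = z at h
  cases h with
  | gen pre q' f' hq hf hflag =>
    cases (eq_of_append_cons_eq (p := IsHead) hz.symm not_isHead_of_mem_cells
      (by simp) (by exact trivial)).2.1
  | back pre c post hflag h =>
    obtain ⟨rfl, he, rfl⟩ := eq_of_append_cons_eq (p := IsHead) hz.symm not_isHead_of_mem_cells
      not_isHead_of_mem_cells (by exact trivial)
    cases he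
    exact ⟨pre, post, rfl, rfl, hflag, h⟩
  | sweep pre c post v q hflag hv hq h =>
    cases (eq_of_append_cons_eq (p := IsHead) hz.symm not_isHead_of_mem_cells
      not_isHead_of_mem_cells (by exact trivial)).2.1
  | check pre c post q hflag hq h =>
    cases (eq_of_append_cons_eq (p := IsHead) hz.symm not_isHead_of_mem_terminals
      not_isHead_of_mem_cells (by exact trivial)).2.1
  | done w v h h' =>
    have := congrArg (nonterminal (back c) ∈ ·) hz
    simp at this

theorem simForm_sweep_inv {A B : List (Symbol T (SimNT T Δ σI σE σA))} {c : Cell T Δ} {q : σE}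
    (h : SimForm MI ME MA (A ++ nonterminal (sweep q c) :: B)) :
    ∃ (pre post : List (Cell T Δ)) (v : List Δ),
      A = pre.map (fun c => nonterminal (cell c)) ∧
      B = post.map (fun c => nonterminal (cell c)) ∧
      TapeFlags ((pre ++ c :: post).map Cell.flags) ∧ v.length = pre.length ∧
      q = ME.eval (v.zip (pre.map Cell.val)) ∧
      Reached MI ME ((pre ++ c :: post).map Cell.sym) (v ++ (c :: post).map Cell.val) := by
  generalize hz : A ++ nonterminal (sweep q c) :: B = z at h
  cases h with
  | gen pre q' f' hq hf hflag =>
    cases (eq_of_append_cons_eq (p := IsHead) hz.symm not_isHead_of_mem_cells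
      (by simp) (by exact trivial)).2.1
  | back pre c post hflag h =>
    cases (eq_of_append_cons_eq (p := IsHead) hz.symm not_isHead_of_mem_cells
      not_isHead_of_mem_cells (by exact trivial)).2.1
  | sweep pre c post v q hflag hv hq h =>
    obtain ⟨rfl, he, rfl⟩ := eq_of_append_cons_eq (p := IsHead) hz.symm not_isHead_of_mem_cells
      not_isHead_of_mem_cells (by exact trivial)
    cases he
    exact ⟨pre, post, v, rfl, rfl, hflag, hv, hq, h⟩
  | check pre c post q hflag hq h =>
    cases (eq_of_append_cons_eq (p := IsHead) hz.symm not_isHead_of_mem_terminals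
      not_isHead_of_mem_cells (by exact trivial)).2.1
  | done w v h h' =>
    have := congrArg (nonterminal (sweep q c) ∈ ·) hz
    simp at this

theorem simForm_check_inv {A B : List (Symbol T (SimNT T Δ σI σE σA))} {c : Cell T Δ} {q : σA}
    (h : SimForm MI ME MA (A ++ nonterminal (check q c) :: B)) :
    ∃ pre post : List (Cell T Δ),
      A = pre.map (fun c => terminal c.sym) ∧
      B = post.map (fun c => nonterminal (cell c)) ∧
      TapeFlags ((pre ++ c :: post).map Cell.flags) ∧ q = MA.eval (pre.map Cell.val) ∧
      Reached MI ME ((pre ++ c :: post).map Cell.sym) ((pre ++ c :: post).map Cell.val) := by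
  generalize hz : A ++ nonterminal (check q c) :: B = z at h
  cases h with
  | gen pre q' f' hq hf hflag =>
    cases (eq_of_append_cons_eq (p := IsHead) hz.symm not_isHead_of_mem_cells
      (by simp) (by exact trivial)).2.1
  | back pre c post hflag h =>
    cases (eq_of_append_cons_eq (p := IsHead) hz.symm not_isHead_of_mem_cells
      not_isHead_of_mem_cells (by exact trivial)).2.1
  | sweep pre c post v q hflag hv hq h =>
    cases (eq_of_append_cons_eq (p := IsHead) hz.symm not_isHead_of_mem_cells
      not_isHead_of_mem_cells (by exact trivial)).2.1
  | check pre c post q hflag hq h =>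
    obtain ⟨rfl, he, rfl⟩ := eq_of_append_cons_eq (p := IsHead) hz.symm
      not_isHead_of_mem_terminals not_isHead_of_mem_cells (by exact trivial)
    cases he
    exact ⟨pre, post, rfl, rfl, hflag, hq, h⟩
  | done w v h h' =>
    have := congrArg (nonterminal (check q c) ∈ ·) hz
    simp at this

/-- Sentential forms are preserved by the productions: the unique symbol with the head determines
the kind of the sentential form and the place where a production applies. -/
theorem SimForm.step {γ δ x y : List (Symbol T (SimNT T Δ σI σE σA))}
    (hx : SimForm MI ME MA (γ ++ x ++ δ)) (h : SimRule MI ME MA x y) :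
    SimForm MI ME MA (γ ++ y ++ δ) := by
  cases h with
  | gen q f t a =>
    obtain ⟨pre, rfl, rfl, hq, hf, hflag⟩ := simForm_gen_inv (by simpa using hx)
    have := SimForm.gen (MI := MI) (ME := ME) (MA := MA) (pre ++ [⟨t, a, f, false⟩])
      (MI.step q (t, a)) false (by simp [hq]) (by simp)
      (by simpa [Cell.flags] using hflag.snoc (f := f) (by simpa using hf))
    simpa using this
  | genEnd q f t a hacc =>
    obtain ⟨pre, rfl, rfl, hq, hf, hflag⟩ := simForm_gen_inv (by simpa using hx)
    have := SimForm.back (MI := MI) (ME := ME) (MA := MA) pre ⟨t, a, f, true⟩ []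
      (by simpa [Cell.flags] using hflag.tapeFlags (f := f) (by simpa using hf))
      ⟨_, by simp, by
        rw [List.zip_map', List.map_append, DFA.mem_accepts, List.map_singleton,
          DFA.eval_append_singleton, ← hq]
        exact hacc, .refl⟩
    simpa using this
  | back c c' =>
    obtain ⟨pre, post, hpre, rfl, hflag, h⟩ :=
      simForm_back_inv (A := γ ++ [nonterminal (cell c)]) (B := δ) (c := c') (by simpa using hx)
    obtain ⟨pre, e, rfl, rfl, he⟩ := List.append_eq_map_iff.1 hpre
    obtain ⟨c, rfl, hc⟩ : ∃ d, e = [d] ∧ d = c := by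
      obtain ⟨d, rfl, hd⟩ := List.map_eq_singleton_iff.1 he
      exact ⟨d, rfl, by simpa using hd⟩
    subst hc
    have := SimForm.back (MI := MI) (ME := ME) (MA := MA) pre c (c' :: post)
      (by simpa using hflag) (by simpa using h)
    simpa using this
  | sweepStart c hc =>
    obtain ⟨pre, post, rfl, rfl, hflag, h⟩ := simForm_back_inv (by simpa using hx)
    obtain rfl := hflag.eq_nil_left hc
    have := SimForm.sweep (MI := MI) (ME := ME) (MA := MA) [] c post [] ME.start hflag rfl rfl
      (by simpa using h)
    simpa using this
  | sweep q c c' b =>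
    obtain ⟨pre, post', v, rfl, hpost, hflag, hv, hq, h⟩ := simForm_sweep_inv
      (B := nonterminal (cell c') :: δ) (by simpa using hx)
    obtain ⟨c', post, rfl, hc, rfl⟩ := List.map_eq_cons_iff.1 hpost.symm
    cases hc
    have := SimForm.sweep (MI := MI) (ME := ME) (MA := MA) (pre ++ [{ c with val := b }]) c' post
      (v ++ [c.val]) (ME.step q (c.val, b)) (by simpa [Cell.flags] using hflag) (by simp [hv])
      (by rw [List.map_append, List.zip_append (by simpa using hv)]; simp [hq])
      (by simpa using h)
    simpa using this
  | sweepEnd q c b hc hacc =>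
    obtain ⟨pre, post, v, rfl, rfl, hflag, hv, hq, h⟩ := simForm_sweep_inv (by simpa using hx)
    obtain rfl := hflag.eq_nil_right hc
    have := SimForm.back (MI := MI) (ME := ME) (MA := MA) pre { c with val := b } []
      (by simpa [Cell.flags] using hflag) (by
        obtain ⟨v₀, h1, h2, h3⟩ := h
        refine ⟨v₀, by simpa using h1, by simpa using h2, h3.tail ⟨by simp [hv], ?_⟩⟩
        rw [List.map_append, List.zip_append (by simpa using hv), DFA.mem_accepts,
          List.map_singleton, List.map_singleton, List.zip_cons_cons, List.zip_nil_left,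
          DFA.eval_append_singleton, ← hq]
        exact hacc)
    simpa using this
  | checkStart c hc =>
    obtain ⟨pre, post, rfl, rfl, hflag, h⟩ := simForm_back_inv (by simpa using hx)
    obtain rfl := hflag.eq_nil_left hc
    have := SimForm.check (MI := MI) (ME := ME) (MA := MA) [] c post MA.start hflag rfl h
    simpa using this
  | check q c c' =>
    obtain ⟨pre, post', rfl, hpost, hflag, hq, h⟩ := simForm_check_inv
      (B := nonterminal (cell c') :: δ) (by simpa using hx)
    obtain ⟨c', post, rfl, hc, rfl⟩ := List.map_eq_cons_iff.1 hpost.symm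
    cases hc
    have := SimForm.check (MI := MI) (ME := ME) (MA := MA) (pre ++ [c]) c' post
      (MA.step q c.val) (by simpa using hflag) (by simp [hq]) (by simpa using h)
    simpa using this
  | checkEnd q c hc hacc =>
    obtain ⟨pre, post, rfl, rfl, hflag, hq, h⟩ := simForm_check_inv (by simpa using hx)
    obtain rfl := hflag.eq_nil_right hc
    have := SimForm.done (MI := MI) (ME := ME) (MA := MA) ((pre ++ [c]).map Cell.sym)
      ((pre ++ [c]).map Cell.val) h (by
        rw [List.map_append, DFA.mem_accepts, List.map_singleton, DFA.eval_append_singleton, ← hq]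
        exact hacc)
    simpa [Function.comp_def] using this

variable [Finite T] [Finite Δ] [Finite σI] [Finite σE] [Finite σA]

/-- Soundness of the simulation: every derivable sentential form is described by `SimForm`. -/
theorem exists_reached_of_mem_language {w : List T} (h : w ∈ (simGrammar MI ME MA).language) :
    ∃ v, Reached MI ME w v ∧ v ∈ MA.accepts := by
  have H : ∀ x, ReflTransGen (simGrammar MI ME MA).Produces
      [nonterminal (simGrammar MI ME MA).start] x → SimForm MI ME MA x := by
    intro x hx
    induction hx with
    | refl =>
      exact SimForm.gen [] MI.start true rfl (fun _ => rfl) (fun p₁ c p₂ h => by simp at h)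
    | tail _ h ih =>
      obtain ⟨r, hr, γ, δ, rfl, rfl⟩ := h
      exact ih.step hr
  have hw := H _ h
  have hno : ∀ a : SimNT T Δ σI σE σA, nonterminal a ∉ w.map terminal := by simp
  generalize hz : w.map terminal = z at hw
  cases hw with
  | done w' v h h' =>
    have : w = w' := List.map_injective_iff.2 (fun a b h => by simpa using h) hz
    exact ⟨v, this ▸ h, h'⟩
  | _ =>
    exact (hno _ (hz ▸ List.mem_append_right _ List.mem_cons_self)).elim

end Simulation

section Completeness

open Symbol SimNT

variable {T : Type u} {Δ σI σE σA : Type} {MI : DFA (T × Δ) σI} {ME : DFA (Δ × Δ) σE}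
  {MA : DFA Δ σA}

theorem RewriteStep.derives_append {α : Type*} {K : Set (List α × List α)} {x y : List α}
    (h : ReflTransGen (RewriteStep K) x y) (a b : List α) :
    ReflTransGen (RewriteStep K) (a ++ x ++ b) (a ++ y ++ b) :=
  ReflTransGen.lift (fun x => a ++ x ++ b) (fun _ _ h => h.append a b) _ _ h

/-- One derivation step of the simulating grammar. -/
abbrev SimStep (MI : DFA (T × Δ) σI) (ME : DFA (Δ × Δ) σE) (MA : DFA Δ σA) :
    List (Symbol T (SimNT T Δ σI σE σA)) → List (Symbol T (SimNT T Δ σI σE σA)) → Prop :=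
  RewriteStep {r | SimRule MI ME MA r.1 r.2}

theorem SimRule.derives {x y : List (Symbol T (SimNT T Δ σI σE σA))}
    (h : SimRule MI ME MA x y) (γ δ : List (Symbol T (SimNT T Δ σI σE σA))) :
    ReflTransGen (SimStep MI ME MA) (γ ++ x ++ δ) (γ ++ y ++ δ) :=
  .single ⟨(x, y), h, γ, δ, rfl, rfl⟩

/-- The tape with the given contents; `f` is the flag of the leftmost cell. -/
def tape (f : Bool) : List (T × Δ) → List (Cell T Δ)
  | [] => []
  | [x] => [⟨x.1, x.2, f, true⟩]
  | x :: y :: L => ⟨x.1, x.2, f, false⟩ :: tape false (y :: L)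

/-- The sentential form in which the head `h` is at the first of the given cells. -/
def withHead (h : Cell T Δ → SimNT T Δ σI σE σA) :
    List (Cell T Δ) → List (Symbol T (SimNT T Δ σI σE σA))
  | [] => []
  | c :: L => nonterminal (h c) :: L.map fun c => nonterminal (cell c)

/-- The head creates a tape whose contents are accepted by the initial automaton. -/
theorem simStep_gen (L : List (T × Δ)) (x : T × Δ) (q : σI) (f : Bool)
    (h : MI.evalFrom q (x :: L) ∈ MI.accept) : ∃ pre c, tape f (x :: L) = pre ++ [c] ∧
      ReflTransGen (SimStep MI ME MA) [nonterminal (gen q f)]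
        (pre.map (fun c => nonterminal (cell c)) ++ [nonterminal (back c)]) := by
  induction L generalizing x q f with
  | nil =>
    exact ⟨[], ⟨x.1, x.2, f, true⟩, rfl,
      by simpa using SimRule.derives (SimRule.genEnd q f x.1 x.2 h) [] []⟩
  | cons y L ih =>
    obtain ⟨pre, c, h1, h2⟩ := ih y (MI.step q x) false h
    refine ⟨⟨x.1, x.2, f, false⟩ :: pre, c, by rw [tape, h1]; rfl, ?_⟩
    have h3 := SimRule.derives (MI := MI) (ME := ME) (MA := MA)
      (SimRule.gen q f x.1 x.2) [] []
    refine .trans h3 ?_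
    have h4 := RewriteStep.derives_append h2 [nonterminal (cell ⟨x.1, x.2, f, false⟩)] []
    simpa using h4

/-- The head returns to the left end. -/
theorem simStep_back (pre : List (Cell T Δ)) (c : Cell T Δ)
    (B : List (Symbol T (SimNT T Δ σI σE σA))) :
    ReflTransGen (SimStep MI ME MA)
      (pre.map (fun c => nonterminal (cell c)) ++ nonterminal (back c) :: B)
      (withHead back (pre ++ [c]) ++ B) := by
  induction pre using List.reverseRecOn generalizing c B with
  | nil => exact .refl
  | append_singleton pre d ih =>
    have h1 := SimRule.derives (MI := MI) (ME := ME) (MA := MA) (SimRule.back d c)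
      (pre.map fun c => nonterminal (cell c)) B
    refine .trans (b := pre.map (fun c => nonterminal (cell c)) ++
      nonterminal (back d) :: nonterminal (cell c) :: B) (by simpa using h1) ?_
    have h2 := ih d (nonterminal (cell c) :: B)
    cases pre <;> simpa [withHead] using h2

/-- A sweep; the entries of the list are an input letter, the current letter and the new letter. -/
theorem simStep_sweep (L : List (T × Δ × Δ)) (x : T × Δ × Δ) (q : σE) (f : Bool)
    (h : ME.evalFrom q ((x :: L).map Prod.snd) ∈ ME.accept) :
    ∃ pre c, tape f ((x :: L).map fun z => (z.1, z.2.2)) = pre ++ [c] ∧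
      ReflTransGen (SimStep MI ME MA)
        (withHead (sweep q) (tape f ((x :: L).map fun z => (z.1, z.2.1))))
        (pre.map (fun c => nonterminal (cell c)) ++ [nonterminal (back c)]) := by
  induction L generalizing x q f with
  | nil =>
    refine ⟨[], ⟨x.1, x.2.2, f, true⟩, rfl, ?_⟩
    simpa [tape, withHead] using SimRule.derives (MI := MI) (ME := ME) (MA := MA)
      (SimRule.sweepEnd q ⟨x.1, x.2.1, f, true⟩ x.2.2 rfl h) [] []
  | cons y L ih =>
    obtain ⟨pre, c, h1, h2⟩ := ih y (ME.step q x.2) false h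
    refine ⟨⟨x.1, x.2.2, f, false⟩ :: pre, c, ?_, ?_⟩
    · simp only [List.map_cons] at h1 ⊢
      rw [tape, h1]
      rfl
    · have h4 := RewriteStep.derives_append h2
        [nonterminal (cell ⟨x.1, x.2.2, f, false⟩)] []
      obtain ⟨c₀, L₀, h5⟩ : ∃ c₀ L₀, tape false ((y :: L).map fun z => (z.1, z.2.1)) =
          c₀ :: L₀ := by
        cases L <;> exact ⟨_, _, rfl⟩
      rw [h5] at h4
      simp only [List.map_cons] at h5 ⊢
      rw [tape, h5]
      have h3 := SimRule.derives (MI := MI) (ME := ME) (MA := MA)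
        (SimRule.sweep q ⟨x.1, x.2.1, f, false⟩ c₀ x.2.2) [] (L₀.map fun c => nonterminal (cell c))
      refine .trans h3 ?_
      simpa [withHead] using h4

/-- The final check releases the input letters. -/
theorem simStep_check (L : List (T × Δ)) (x : T × Δ) (q : σA) (f : Bool)
    (h : MA.evalFrom q ((x :: L).map Prod.snd) ∈ MA.accept) :
    ReflTransGen (SimStep MI ME MA) (withHead (check q) (tape f (x :: L)))
      ((x :: L).map fun z => terminal z.1) := by
  induction L generalizing x q f with
  | nil =>
    simpa [tape, withHead] using SimRule.derives (MI := MI) (ME := ME) (MA := MA)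
      (SimRule.checkEnd q ⟨x.1, x.2, f, true⟩ rfl h) [] []
  | cons y L ih =>
    have h2 := ih y (MA.step q x.2) false h
    have h4 := RewriteStep.derives_append h2 [terminal x.1] []
    obtain ⟨c₀, L₀, h5⟩ : ∃ c₀ L₀, tape false (y :: L) = c₀ :: L₀ := by
      cases L <;> exact ⟨_, _, rfl⟩
    rw [h5] at h4
    rw [tape, h5]
    have h3 := SimRule.derives (MI := MI) (ME := ME) (MA := MA)
      (SimRule.check q ⟨x.1, x.2, f, false⟩ c₀) [] (L₀.map fun c => nonterminal (cell c))
    refine .trans h3 ?_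
    simpa [withHead] using h4

/-- Completeness of the simulation. -/
theorem mem_language_simGrammar [Finite T] [Finite Δ] [Finite σI] [Finite σE] [Finite σA]
    {w : List T} {v : List Δ} (hw : w ≠ [])
    (h : Reached MI ME w v) (hv : v ∈ MA.accepts) : w ∈ (simGrammar MI ME MA).language := by
  obtain ⟨v₀, hlen, hI, hE⟩ := h
  have hback : ∀ pre c, ReflTransGen (SimStep MI ME MA)
      (pre.map (fun c => nonterminal (cell c)) ++ [nonterminal (back c)])
      (withHead back (pre ++ [c])) := fun pre c => by
    simpa using simStep_back (MI := MI) (ME := ME) (MA := MA) pre c []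
  have hstart : ∀ (h : Cell T Δ → SimNT T Δ σI σE σA)
      (_ : ∀ c : Cell T Δ, c.first = true → SimRule MI ME MA [nonterminal (back c)]
        [nonterminal (h c)]) (L : List (T × Δ)),
      ReflTransGen (SimStep MI ME MA) (withHead back (tape true L))
        (withHead h (tape true L)) := by
    rintro h hr (_ | ⟨x, _ | ⟨y, L⟩⟩)
    · exact .refl
    · exact SimRule.derives (hr ⟨x.1, x.2, true, true⟩ rfl) [] []
    · exact SimRule.derives (hr ⟨x.1, x.2, true, false⟩ rfl) []
        ((tape false (y :: L)).map fun c => nonterminal (cell c))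
  have hne : ∀ {α : Type _} {v : List α}, v.length = w.length → ∃ a v', v = a :: v' := by
    rintro α (_ | ⟨a, v'⟩) he
    · exact (hw (List.eq_nil_of_length_eq_zero he.symm)).elim
    · exact ⟨a, v', rfl⟩
  have H : v.length = w.length ∧ ReflTransGen (SimStep MI ME MA)
      [nonterminal (gen MI.start true)] (withHead back (tape true (w.zip v))) := by
    clear hv
    induction hE with
    | refl =>
      refine ⟨hlen, ?_⟩
      obtain ⟨x, L, hL⟩ := hne (v := w.zip v₀) (by simp [hlen])
      rw [hL] at hI ⊢
      obtain ⟨pre, c, h1, h2⟩ := simStep_gen (ME := ME) (MA := MA) L x MI.start true hI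
      rw [h1]
      exact h2.trans (hback pre c)
    | @tail v v' _ hs ih =>
      obtain ⟨ih1, ih2⟩ := ih
      have hv' : v'.length = w.length := hs.1.symm.trans ih1
      refine ⟨hv', ih2.trans ((hstart (sweep ME.start) (fun c hc => .sweepStart c hc) _).trans ?_)⟩
      obtain ⟨x, L, hL⟩ := hne (v := w.zip (v.zip v')) (by simp [ih1, hv'])
      have e1 : (x :: L).map (fun z => (z.1, z.2.1)) = w.zip v := by
        have : (w.zip (v.zip v')).map (fun z => (z.1, z.2.1)) =
            w.zip ((v.zip v').map Prod.fst) := by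
          rw [List.zip_map_right]; rfl
        rw [← hL, this, List.map_fst_zip hs.1.le]
      have e2 : (x :: L).map (fun z => (z.1, z.2.2)) = w.zip v' := by
        have : (w.zip (v.zip v')).map (fun z => (z.1, z.2.2)) =
            w.zip ((v.zip v').map Prod.snd) := by
          rw [List.zip_map_right]; rfl
        rw [← hL, this, List.map_snd_zip hs.1.ge]
      have e3 : (x :: L).map Prod.snd = v.zip v' := by
        rw [← hL, List.map_snd_zip (by simp [ih1, hv'])]
      obtain ⟨pre, c, h1, h2⟩ := simStep_sweep (MI := MI) (ME := ME) (MA := MA) L x ME.start true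
        (by rw [e3]; exact hs.2)
      rw [e1] at h2
      rw [e2] at h1
      rw [h1]
      exact h2.trans (hback pre c)
  obtain ⟨hl, H⟩ := H
  obtain ⟨x, L, hL⟩ := hne (v := w.zip v) (by simp [hl])
  have h1 := simStep_check (MI := MI) (ME := ME) (MA := MA) L x MA.start true
    (by rw [← hL, List.map_snd_zip hl.le]; exact hv)
  rw [← hL] at h1
  have h2 : (w.zip v).map (fun z => (terminal z.1 : Symbol T (SimNT T Δ σI σE σA))) =
      w.map terminal := by
    have : (w.zip v).map (fun z => (terminal z.1 : Symbol T (SimNT T Δ σI σE σA))) =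
      ((w.zip v).map Prod.fst).map terminal := by rw [List.map_map]; rfl
    rw [this, List.map_fst_zip hl.ge]
  rw [h2] at h1
  exact H.trans ((hstart (check MA.start) (fun c hc => .checkStart c hc) _).trans h1)

end Completeness

theorem zip_ofFn {α β : Type*} {n : ℕ} (u : Fin n → α) (v : Fin n → β) :
    (List.ofFn u).zip (List.ofFn v) = List.ofFn fun i => (u i, v i) := by
  refine (List.zip_of_prod ?_ ?_).symm <;> rw [List.map_ofFn] <;> rfl

theorem exists_eq_ofFn {α : Type*} {n : ℕ} {l : List α} (h : l.length = n) :
    ∃ u : Fin n → α, l = List.ofFn u := by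
  subst h
  exact ⟨l.get, (List.ofFn_get l).symm⟩

/-- Every property of words in nondeterministic linear space defines a context sensitive
language. -/
theorem NLin.exists_grammar {T : Type u} [Finite T] {P : ∀ n : ℕ, (Fin (n + 1) → T) → Prop}
    (h : NLin P) : ∃ g : ContextSensitiveGrammar T,
      ∀ w, w ∈ g.language ↔ ∃ n u, w = List.ofFn u ∧ P n u := by
  obtain ⟨d, I, E, A, h⟩ := h
  obtain ⟨_, ⟨σI, _, MI, rfl⟩, hI⟩ := h.init
  obtain ⟨_, ⟨σE, _, ME, rfl⟩, hE⟩ := h.step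
  obtain ⟨_, ⟨σA, _, MA, rfl⟩, hA⟩ := h.final
  have hI' : ∀ {n} (u : Fin (n + 1) → T) a, I n u a ↔
      (List.ofFn u).zip (List.ofFn a) ∈ MI.accepts := fun u a => by
    rw [zip_ofFn]; exact hI _ fun i => (u i, a i)
  have hE' : ∀ {n} (a b : Fin (n + 1) → Fin (d + 1)), E n a b ↔
      machineStep ME (List.ofFn a) (List.ofFn b) := fun a b => by
    rw [machineStep, zip_ofFn]
    simpa using hE _ fun i => (a i, b i)
  refine ⟨simGrammar MI ME MA, fun w => ⟨fun hw => ?_, ?_⟩⟩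
  · have hlen : 1 ≤ w.length := by
      have : ∀ x, ReflTransGen (simGrammar MI ME MA).Produces
          [Symbol.nonterminal (simGrammar MI ME MA).start] x → 1 ≤ x.length := by
        intro x hx
        induction hx with
        | refl => simp
        | tail _ h ih => exact ih.trans ((simGrammar MI ME MA).length_le_of_produces h)
      simpa using this _ hw
    obtain ⟨n, hn⟩ := Nat.exists_eq_add_of_le' hlen
    obtain ⟨u, rfl⟩ := exists_eq_ofFn hn
    obtain ⟨v, ⟨v₀, h1, h2, h3⟩, h4⟩ := exists_reached_of_mem_language hw
    obtain ⟨a, rfl⟩ := exists_eq_ofFn (h1.trans hn)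
    have H : ∃ b, v = List.ofFn b ∧ ReflTransGen (E n) a b := by
      clear h4
      induction h3 with
      | refl => exact ⟨a, rfl, .refl⟩
      | tail _ hs ih =>
        obtain ⟨b, rfl, hb⟩ := ih
        obtain ⟨c, rfl⟩ := exists_eq_ofFn (hs.1.symm.trans List.length_ofFn)
        exact ⟨c, rfl, hb.tail ((hE' b c).2 hs)⟩
    obtain ⟨b, rfl, hab⟩ := H
    exact ⟨n, u, rfl, (h.iff n u).2 ⟨a, b, (hI' u a).2 h2, hab, (hA n b).2 h4⟩⟩
  · rintro ⟨n, u, rfl, hu⟩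
    obtain ⟨a, b, ha, hab, hb⟩ := (h.iff n u).1 hu
    refine mem_language_simGrammar (v := List.ofFn b) (by simp)
      ⟨List.ofFn a, by simp, (hI' u a).1 ha, ?_⟩ ((hA n b).1 hb)
    exact ReflTransGen.lift List.ofFn (fun a b h => (hE' a b).1 h) _ _ hab

/-! ### Forbidden blocks of the generated shift -/

/-- Conditions on pairs of adjacent letters are regular: an automaton remembers the last letter.
Its state is `none` after a violation and `some none` before the first letter. -/
theorem RegPred.chain {Γ : Type*} [Finite Γ] (r : Γ → Γ → Prop) :
    RegPred fun n (u : Fin (n + 1) → Γ) => ∀ i : Fin n, r (u i.castSucc) (u i.succ) := by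
  classical
  have := Fintype.ofFinite Γ
  let D : DFA Γ (Option (Option Γ)) :=
    { step := fun s b => s.bind fun o => if ∀ a ∈ o, r a b then some (some b) else none
      start := some none
      accept := {s | s ≠ none} }
  have key : ∀ x : List Γ, D.eval x = if x.IsChain r then some x.getLast? else none := by
    intro x
    induction x using List.reverseRecOn with
    | nil => simp [D, DFA.eval_nil]
    | append_singleton x b ih =>
      rw [DFA.eval_append_singleton, ih]
      have hstep : ∀ s, D.step s b =
        s.bind fun o => if ∀ a ∈ o, r a b then some (some b) else none := fun _ => rfl
      rw [hstep]
      by_cases hx : x.IsChain r <;> simp [hx, List.isChain_append]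
  refine ⟨D.accepts, Language.isRegular_iff.2 ⟨_, inferInstance, D, rfl⟩, fun n u => ?_⟩
  have h1 : List.ofFn u ∈ D.accepts ↔ (List.ofFn u).IsChain r := by
    rw [DFA.mem_accepts, key]
    change _ ≠ none ↔ _
    split_ifs with h
    · exact iff_of_true (Option.some_ne_none _) h
    · exact iff_of_false (fun h => h rfl) h
  rw [h1, List.isChain_iff_getElem]
  constructor
  · intro h i hi
    rw [List.getElem_ofFn, List.getElem_ofFn]
    exact h ⟨i, by rw [List.length_ofFn] at hi; omega⟩
  · intro h i
    have := h i (by rw [List.length_ofFn]; omega)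
    rw [List.getElem_ofFn, List.getElem_ofFn] at this
    exact this

section

variable {A : Type u} {F : Set (A → A)}

/-- A block is not forbidden if and only if some window of some point of `S` drives it. -/
theorem predecessors_zero_ne_empty_iff (S : Set (ℤ → F)) (x : List A) :
    predecessors S 0 x ≠ ∅ ↔ ∃ z ∈ S, ∃ k : ℤ, ∀ (i : ℕ) (hi : i + 1 < x.length),
      x[i + 1] = (z (k + i) : A → A) x[i] := by
  rw [← Set.nonempty_iff_ne_empty]
  constructor
  · rintro ⟨y, a, ha, rfl, f, ⟨hf, z, hz, k, hk⟩, hy⟩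
    obtain rfl := List.eq_nil_of_length_eq_zero ha
    refine ⟨z, hz, k, fun i hi => ?_⟩
    have hi' : i < f.length := by rw [hf]; simp; omega
    rw [hk i hi']
    exact hy i hi hi'
  · rintro ⟨z, hz, k, hk⟩
    refine ⟨x, [], rfl, rfl, List.ofFn fun i : Fin (x.length - 1) => z (k + i),
      ⟨by simp, z, hz, k, fun i hi => by simp⟩, fun i hi _ => ?_⟩
    simpa using hk i hi

theorem mem_forbiddenBlocks_iff (S : Set (ℤ → F)) (x : List A) :
    x ∈ forbiddenBlocks S ↔ ¬ ∃ z ∈ S, ∃ k : ℤ, ∀ (i : ℕ) (hi : i + 1 < x.length),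
      x[i + 1] = (z (k + i) : A → A) x[i] := by
  rw [← predecessors_zero_ne_empty_iff, not_not]
  rfl

/-- A block of length `n + 1` is not forbidden if and only if it is driven by a block of the same
length in the language of `S`, whose last entry is irrelevant. -/
theorem ofFn_notMem_forbiddenBlocks_iff (S : Set (ℤ → F)) {n : ℕ} (x : Fin (n + 1) → A) :
    List.ofFn x ∉ forbiddenBlocks S ↔ ∃ f : Fin (n + 1) → F, List.ofFn f ∈ shiftLanguage S ∧
      ∀ i : Fin n, x i.succ = (f i.castSucc : A → A) (x i.castSucc) := by
  rw [mem_forbiddenBlocks_iff, not_not]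
  constructor
  · rintro ⟨z, hz, k, hk⟩
    refine ⟨fun i => z (k + (i : ℕ)), Set.mem_iUnion.2 ⟨n + 1, by simp, z, hz, k, fun i hi => ?_⟩,
      fun i => ?_⟩
    · rw [List.getElem_ofFn]
    · have := hk i (by simp)
      simp only [List.getElem_ofFn] at this
      exact this
  · rintro ⟨f, hf, hx⟩
    obtain ⟨m, -, z, hz, k, hk⟩ := Set.mem_iUnion.1 hf
    refine ⟨z, hz, k, fun i hi => ?_⟩
    have hi' : i < n := by simpa using hi
    rw [hk i (by simp; omega)]
    simp only [List.getElem_ofFn]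
    exact hx ⟨i, hi'⟩

theorem isContextSensitive_forbiddenBlocks [Finite A] (S : Set (ℤ → F))
    (hCS : IsContextSensitive (shiftLanguage S)) : IsContextSensitive (forbiddenBlocks S) := by
  obtain ⟨g, hg⟩ := hCS
  have h1 : NLin (Γ := A × F) fun n w => List.ofFn (fun i => (w i).2) ∈ shiftLanguage S ∧
      ∀ i : Fin n, (w i.succ).1 = ((w i.castSucc).2 : A → A) (w i.castSucc).1 := by
    refine NLin.and ?_ (RegPred.chain fun a b : A × F => b.1 = (a.2 : A → A) a.1).nlin
    refine (g.nlin_language.comap Prod.snd).congr fun n w => ?_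
    rw [hg]
    simp
  have h2 : NLin fun n (x : Fin (n + 1) → A) => List.ofFn x ∉ forbiddenBlocks S :=
    (NLin.exists (Δ := F) (R := fun n x f => List.ofFn f ∈ shiftLanguage S ∧
      ∀ i : Fin n, x i.succ = (f i.castSucc : A → A) (x i.castSucc)) h1).congr
      fun n x => ofFn_notMem_forbiddenBlocks_iff S x
  obtain ⟨g', hg'⟩ := h2.not.exists_grammar
  refine ⟨g', fun w => ?_⟩
  rw [hg']
  constructor
  · rintro ⟨n, x, rfl, hx⟩
    exact ⟨not_not.1 hx, by simp⟩
  · rintro ⟨hw, hne⟩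
    obtain ⟨n, hn⟩ := Nat.exists_eq_add_of_le' (List.length_pos_iff.2 hne)
    obtain ⟨x, rfl⟩ := exists_eq_ofFn hn
    exact ⟨n, x, rfl, not_not.2 hw⟩

theorem IsShiftSpace.shift_mem {T : Type u} {X : Set (ℤ → T)} (hX : IsShiftSpace X) {z : ℤ → T}
    (hz : z ∈ X) (m : ℤ) : (fun i => z (m + i)) ∈ X := by
  obtain ⟨B, rfl⟩ := hX
  rintro w hw ⟨k, hk⟩
  exact hz w hw ⟨m + k, fun i hi => by rw [add_assoc]; exact hk i hi⟩

theorem IsShiftSpace.isClosed {T : Type u} [TopologicalSpace T] [DiscreteTopology T]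
    {X : Set (ℤ → T)} (hX : IsShiftSpace X) : IsClosed X := by
  obtain ⟨B, rfl⟩ := hX
  have : shiftOfForbidden B = ⋂ w ∈ B, ⋂ k : ℤ, (⋂ i : Fin w.length,
      (fun x : ℤ → T => x (k + (i : ℕ))) ⁻¹' {w[i]})ᶜ := by
    ext x
    simp only [shiftOfForbidden, Occurs, Set.mem_ofPred_eq, Set.mem_iInter, Set.mem_compl_iff,
      Set.mem_preimage, Set.mem_singleton_iff, not_exists]
    refine forall₂_congr fun w _ => forall_congr' fun k => not_congr ?_
    exact ⟨fun h i => h i i.isLt, fun h i hi => h ⟨i, hi⟩⟩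
  rw [this]
  refine isClosed_biInter fun w _ => isClosed_iInter fun k => IsOpen.isClosed_compl ?_
  exact isOpen_iInter_of_finite fun i => (isOpen_discrete _).preimage (continuous_apply _)

/-- A sequence all of whose blocks are driven by `S` is driven by a point of `S`, by compactness of
`S`. -/
theorem shiftOfForbidden_forbiddenBlocks [Finite A] (S : Set (ℤ → F)) (hS : IsShiftSpace S) :
    shiftOfForbidden (forbiddenBlocks S) = generatedShift S := by
  ext x
  constructor
  · intro hx
    let _ : TopologicalSpace F := ⊥
    have : DiscreteTopology F := ⟨rfl⟩
    let C : ℕ → Set (ℤ → F) := fun N => S ∩ ⋂ i : ℤ, {z : ℤ → F |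
      -(N : ℤ) ≤ i → i < N → x (i + 1) = (z i : A → A) (x i)}
    have hclosed : ∀ N, IsClosed (C N) := fun N => by
      refine hS.isClosed.inter (isClosed_iInter fun i => ?_)
      exact (isClosed_discrete {f : F | -(N : ℤ) ≤ i → i < N →
        x (i + 1) = (f : A → A) (x i)}).preimage
        (continuous_apply i : Continuous fun z : ℤ → F => z i)
    have hmono : ∀ N, C (N + 1) ⊆ C N := fun N z hz => by
      refine ⟨hz.1, Set.mem_iInter.2 fun i h1 h2 => ?_⟩
      exact Set.mem_iInter.1 hz.2 i (by push_cast; omega) (by push_cast; omega)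
    have hne : ∀ N, (C N).Nonempty := fun N => by
      -- The block of `x` between `-N` and `N` is not forbidden.
      have hw : (List.ofFn fun i : Fin (2 * N + 1) => x (-N + (i : ℕ))) ∉ forbiddenBlocks S :=
        fun h => hx _ h ⟨-N, fun i hi => by simp only [List.getElem_ofFn]⟩
      rw [mem_forbiddenBlocks_iff, not_not] at hw
      obtain ⟨z, hz, k, hk⟩ := hw
      refine ⟨fun i => z (k + N + i), hS.shift_mem hz _, Set.mem_iInter.2 fun i h1 h2 => ?_⟩
      obtain ⟨j, hj⟩ := Int.eq_ofNat_of_zero_le (show 0 ≤ i + N by omega)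
      have h := hk j (by rw [List.length_ofFn]; omega)
      simp only [List.getElem_ofFn] at h
      rw [show -(N : ℤ) + ((j + 1 : ℕ) : ℤ) = i + 1 by push_cast; omega,
        show -(N : ℤ) + (j : ℤ) = i by omega, show k + (j : ℤ) = k + N + i by omega] at h
      exact h
    obtain ⟨z, hz⟩ := IsCompact.nonempty_iInter_of_sequence_nonempty_isCompact_isClosed C
      hmono hne (hclosed 0).isCompact hclosed
    rw [Set.mem_iInter] at hz
    refine ⟨z, (hz 0).1, fun i => ?_⟩
    exact Set.mem_iInter.1 (hz (i.natAbs + 1)).2 i (by omega) (by omega)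
  · rintro ⟨z, hz, hzx⟩ w hw ⟨k, hk⟩
    refine (mem_forbiddenBlocks_iff S w).1 hw ⟨z, hz, k, fun i hi => ?_⟩
    rw [← hk i (by omega), ← hk (i + 1) hi, ← hzx]
    push_cast
    rw [add_assoc]

end

end FunctionalShift

theorem mainTheorem6 {A : Type u} [Finite A] [Nonempty A] (F : Set (A → A)) (S : Set (ℤ → F))
    (hS : FunctionalShift.IsShiftSpace S)
    (hCS : FunctionalShift.IsContextSensitive (FunctionalShift.shiftLanguage S)) :
    FunctionalShift.IsContextSensitive (FunctionalShift.forbiddenBlocks S) ∧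
      FunctionalShift.shiftOfForbidden (FunctionalShift.forbiddenBlocks S) =
        FunctionalShift.generatedShift S :=
  ⟨FunctionalShift.isContextSensitive_forbiddenBlocks S hCS,
    FunctionalShift.shiftOfForbidden_forbiddenBlocks S hS⟩
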